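/- Let $A$ be an artin algebra, i.e. a ring that is finitely generated as a module over some commutative artinian ring acting centrally, and let $A\text{-mod}$ be the category of finitely generated left $A$-modules. Let $S$ be a *localizable* $A$-module: a simple $A$-module with $\operatorname{proj.dim}_A S\le 1$ and $\operatorname{Ext}^1_A(S,S)=0$. Let $$S^\perp=\{X\in A\text{-mod}\mid \operatorname{Hom}_A(S,X)=0=\operatorname{Ext}^1_A(S,X)\},$$ let $i\colon S^\perp\to A\text{-mod}$ be the inclusion, $i_\lambda\colon A\text{-mod}\to S^\perp$ its exact left adjoint, $L=i\,i_\lambda$, and $\eta\colon \mathrm{Id}\to L$ the unit of the adjunction. The $A$-module $L(A)$ is an artin algebra with unit $\eta_A(1)$ and multiplication $x\star y=L(\eta_A)^{-1}\bigl(L(r_y)(x)\bigr)$, where $r_y\colon A\to L(A)$, $a\mapsto a.y$; the map $\eta_A\colon A\to L(A)$ is then an algebra homomorphism, called the left retraction associated to $S$. Restriction of scalars along $\eta_A$ identifies $L(A)\text{-mod}$ with $S^\perp$. Under this identification $i\colon L(A)\text{-mod}\to A\text{-mod}$ is restriction of scalars along $\eta_A$, with exact left adjoint $i_\lambda\colon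 A\text{-mod}\to L(A)\text{-mod}$. Denote by $$i_\lambda^*\colon \mathbf D^b(A\text{-mod})\to\mathbf D^b(L(A)\text{-mod}),\qquad i^*\colon \mathbf D^b(L(A)\text{-mod})\to\mathbf D^b(A\text{-mod})$$ the triangle functors obtained by applying $i_\lambda$ and $i$ degreewise to complexes. For an artin algebra $B$ let $\operatorname{perf}(B)\subseteq\mathbf D^b(B\text{-mod})$ be the full subcategory of objects isomorphic to bounded complexes of finitely generated projective modules, and let $\mathbf D_{\rm sg}(B)=\mathbf D^b(B\text{-mod})/\operatorname{perf}(B)$ be the Verdier quotient, with quotient functor $q_B$. Then $i_\lambda^*$ and $i^*$ induce mutually inverse triangle equivalences between $\mathbf D_{\rm sg}(A)$ and $\mathbf D_{\rm sg}(L(A))$. That is, $i_\lambda^*(\operatorname{perf}(A))\subseteq\operatorname{perf}(L(A))$ and $i^*(\operatorname{perf}(L(A)))\subseteq\operatorname{perf}(A)$, and there are mutually quasi-inverse triangle equivalences $\Phi\colon\mathbf D_{\rm sg}(A)\to\mathbf D_{\rm sg}(L(A))$ and $\Psi\colon\mathbf D_{\rm sg}(L(A))\to\mathbf D_{\rm sg}(A)$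 with isomorphisms $\Phi\,q_A\cong q_{L(A)}\,i_\lambda^*$ and $\Psi\,q_{L(A)}\cong q_A\,i^*$ compatible with the shifts. -/

import Mathlib

universe w v u

open CategoryTheory Limits Pretriangulated

noncomputable section

namespace LeftRetraction

section LocalModules

variable {A : Type u} [Ring A] (m : Submodule A A)

/-- The modules `Y` such that every linear map `m → Y` extends uniquely to `A → Y`. -/
structure IsLocal (Y : Type u) [AddCommGroup Y] [Module A Y] : Prop where
  sep : ∀ y : Y, (∀ p ∈ m, p • y = 0) → y = 0
  ext : ∀ f : m →ₗ[A] Y, ∃ y : Y, ∀ p : m, f p = (p : A) • y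

/-- The submodule generated by the elements annihilated by `m`. -/
def tors (M : Type u) [AddCommGroup M] [Module A M] : Submodule A M :=
  Submodule.span A {x | ∀ p ∈ m, p • x = 0}

variable {m}

theorem tors_eq_bot {M : Type u} [AddCommGroup M] [Module A M] (hM : IsLocal m M) :
    tors m M = ⊥ := by
  rw [tors, Submodule.span_eq_bot]
  exact fun x hx => hM.sep x hx

theorem map_tors {M N : Type u} [AddCommGroup M] [Module A M] [AddCommGroup N] [Module A N]
    (f : M →ₗ[A] N) {x : M} (hx : x ∈ tors m M) : f x ∈ tors m N := by
  have : tors m M ≤ (tors m N).comap f := by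
    rw [tors, Submodule.span_le]
    intro x hx
    exact Submodule.subset_span fun p hp => by rw [← map_smul, hx p hp, map_zero]
  exact this hx

theorem isSemisimpleModule_tors (hm : IsCoatom m) (M : Type u) [AddCommGroup M] [Module A M] :
    IsSemisimpleModule A (tors m M) := by
  have hs : IsSimpleModule A (A ⧸ m) := isSimpleModule_iff_isCoatom.2 hm
  have : tors m M = ⨆ x ∈ {x : M | ∀ p ∈ m, p • x = 0}, Submodule.span A {x} := by
    rw [tors, Submodule.span_eq_iSup_of_singleton_spans]
  rw [this]
  apply isSemisimpleModule_biSup_of_isSemisimpleModule_submodule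
  intro x hx
  have h : m ≤ LinearMap.ker (LinearMap.toSpanSingleton A M x) := fun p hp => hx p hp
  have h2 : Submodule.span A {x} =
      LinearMap.range (m.liftQ (LinearMap.toSpanSingleton A M x) h) := by
    rw [Submodule.range_liftQ, LinearMap.range_toSpanSingleton]
  rw [h2]
  exact IsSemisimpleModule.range _

theorem mem_tors_of_injective (hm : IsCoatom m) {K M : Type u} [AddCommGroup K] [Module A K]
    [AddCommGroup M] [Module A M] (f : K →ₗ[A] M) (hf : Function.Injective f) {k : K}
    (hk : f k ∈ tors m M) : k ∈ tors m K := by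
  have := isSemisimpleModule_tors hm M
  let K' := (tors m M).comap f
  let f' : K' →ₗ[A] tors m M := f.restrict fun x hx => hx
  have hf' : Function.Injective f' := fun x y h => Subtype.ext (hf (congrArg Subtype.val h))
  obtain ⟨h, hh⟩ := IsSemisimpleModule.extension_property f' hf' LinearMap.id
  have key : ∀ x (hx : x ∈ tors m M), (h ⟨x, hx⟩ : K) ∈ tors m K := by
    intro x hx
    unfold tors at hx
    induction hx using Submodule.span_induction with
    | mem x hx =>
      refine Submodule.subset_span fun p hp => ?_
      rw [← Submodule.coe_smul, ← map_smul]
      have : p • (⟨x, Submodule.subset_span hx⟩ : tors m M) = 0 := Subtype.ext (hx p hp)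
      erw [this]
      simp
    | zero =>
      have : (⟨0, Submodule.zero_mem _⟩ : tors m M) = 0 := rfl
      erw [this]; simp
    | add x y hx hy h1 h2 =>
      have : (⟨x + y, Submodule.add_mem _ hx hy⟩ : tors m M) = ⟨x, hx⟩ + ⟨y, hy⟩ := rfl
      erw [this]; rw [map_add]; exact Submodule.add_mem _ h1 h2
    | smul a x hx h1 =>
      have : (⟨a • x, Submodule.smul_mem _ a hx⟩ : tors m M) = a • ⟨x, hx⟩ := rfl
      erw [this]; rw [map_smul]; exact Submodule.smul_mem _ a h1
  have := key (f k) hk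
  have h2 : h ⟨f k, hk⟩ = (⟨k, hk⟩ : K') := LinearMap.congr_fun hh ⟨k, hk⟩
  rwa [h2] at this

/-- Injectivity passes to local reflections. -/
theorem injective_of_reflection (hm : IsCoatom m) {X Y LX LY : Type u}
    [AddCommGroup X] [Module A X] [AddCommGroup Y] [Module A Y]
    [AddCommGroup LX] [Module A LX] [AddCommGroup LY] [Module A LY]
    (ηX : X →ₗ[A] LX) (ηY : Y →ₗ[A] LY) (f : X →ₗ[A] Y) (F : LX →ₗ[A] LY)
    (hf : Function.Injective f) (hF : ∀ x, F (ηX x) = ηY (f x)) (hLX : IsLocal m LX)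
    (hker : LinearMap.ker ηY ≤ tors m Y) (hcok : tors m (LX ⧸ LinearMap.range ηX) = ⊤) :
    Function.Injective F := by
  rw [← LinearMap.ker_eq_bot, eq_bot_iff]
  intro k hk
  have h1 : Function.Injective
      ((LinearMap.range ηX).mkQ ∘ₗ (LinearMap.ker F).subtype) := by
    rw [← LinearMap.ker_eq_bot, eq_bot_iff]
    rintro ⟨z, hz⟩ hz'
    obtain ⟨x, rfl⟩ := (Submodule.Quotient.mk_eq_zero _).1 (show (LinearMap.range ηX).mkQ z = 0 from hz')
    have hx : f x ∈ tors m Y := hker (by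
      rw [LinearMap.mem_ker, ← hF]; exact hz)
    have := map_tors ηX (mem_tors_of_injective hm f hf hx)
    rw [tors_eq_bot hLX] at this
    exact Subtype.ext this
  have h2 := mem_tors_of_injective hm _ h1 (k := ⟨k, hk⟩) (hcok ▸ Submodule.mem_top)
  have h3 := map_tors (LinearMap.ker F).subtype h2
  rw [tors_eq_bot hLX] at h3
  exact h3

/-- Modules with a finite free presentation by copies of a local module are local. -/
theorem isLocal_of_presentation [Module.Projective A m] {L N M : Type u} [AddCommGroup L]
    [Module A L] [AddCommGroup N] [Module A N] [AddCommGroup M] [Module A M]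
    (hL : IsLocal m L) (hN : IsLocal m N) (g : L →ₗ[A] N) (q : N →ₗ[A] M)
    (hq : Function.Surjective q) (hgq : LinearMap.ker q = LinearMap.range g) : IsLocal m M := by
  constructor
  · intro y hy
    obtain ⟨x, rfl⟩ := hq y
    have hx : ∀ p : m, (p : A) • x ∈ LinearMap.range g := fun p => by
      rw [← hgq, LinearMap.mem_ker, map_smul]; exact hy p p.2
    let φ : m →ₗ[A] LinearMap.range g :=
      ((LinearMap.toSpanSingleton A N x).domRestrict m).codRestrict _ hx
    obtain ⟨ψ, hψ⟩ := Module.projective_lifting_property g.rangeRestrict φ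
      g.surjective_rangeRestrict
    obtain ⟨z, hz⟩ := hL.ext ψ
    have : x = g z := by
      rw [← sub_eq_zero]
      refine hN.sep _ fun p hp => ?_
      have h : g (ψ ⟨p, hp⟩) = p • x := congrArg Subtype.val (LinearMap.congr_fun hψ ⟨p, hp⟩)
      rw [hz, map_smul] at h
      rw [smul_sub, h, sub_self]
    rw [this, ← LinearMap.mem_ker, hgq]
    exact ⟨z, rfl⟩
  · intro f
    obtain ⟨ψ, hψ⟩ := Module.projective_lifting_property q f hq
    obtain ⟨z, hz⟩ := hN.ext ψ
    refine ⟨q z, fun p => ?_⟩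
    rw [← hψ, LinearMap.comp_apply, hz, map_smul]

theorem IsLocal.pi {ι : Type} {Y : Type u} [AddCommGroup Y] [Module A Y] (hY : IsLocal m Y) :
    IsLocal m (ι → Y) := by
  constructor
  · intro y hy
    funext i
    exact hY.sep _ fun p hp => congrFun (hy p hp) i
  · intro f
    choose y hy using fun i => hY.ext (LinearMap.proj i ∘ₗ f)
    exact ⟨y, fun p => funext fun i => hy i p⟩

theorem exists_generators {R : Type u} [CommRing R] [IsNoetherianRing R] [Algebra R A]
    [Module.Finite R A] (hm : m.FG) (X : Type u) [AddCommGroup X] [Module A X]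
    [Module.Finite A X] : ∃ (n : ℕ) (f : Fin n → (m →ₗ[A] X)), ∀ g : m →ₗ[A] X,
      ∃ c : Fin n → A, (∀ j a, c j * a = a * c j) ∧ ∀ p, g p = ∑ j, c j • f j p := by
  let _ : Module R X := Module.compHom X (algebraMap R A)
  have : IsScalarTower R A X := ⟨fun r a x => by
    rw [Algebra.smul_def, mul_smul]; rfl⟩
  have : SMulCommClass A R X := IsScalarTower.to_smulCommClass'
  have : Module.Finite R X := Module.Finite.trans A X
  have : Module.Finite A m := Module.Finite.iff_fg.2 hm
  obtain ⟨k, s, hs⟩ := Module.Finite.exists_fin (R := A) (M := m)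
  let ev : (m →ₗ[A] X) →ₗ[R] (Fin k → X) :=
    { toFun := fun g i => g (s i), map_add' := fun _ _ => rfl, map_smul' := fun _ _ => rfl }
  have hev : Function.Injective ev := fun g h hgh =>
    LinearMap.ext_on_range hs fun i => congrFun hgh i
  have : Module.Finite R (m →ₗ[A] X) := Module.Finite.of_injective ev hev
  obtain ⟨n, f, hf⟩ := Module.Finite.exists_fin (R := R) (M := m →ₗ[A] X)
  refine ⟨n, f, fun g => ?_⟩
  obtain ⟨c, hc⟩ := (Submodule.mem_span_range_iff_exists_fun R).1 (hf ▸ Submodule.mem_top (x := g))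
  refine ⟨fun j => algebraMap R A (c j), fun j a => Algebra.commutes _ _, fun p => ?_⟩
  rw [← hc, LinearMap.sum_apply]
  exact Finset.sum_congr rfl fun j _ => rfl

theorem exists_reflection {R : Type u} [CommRing R] [IsNoetherianRing R] [Algebra R A]
    [Module.Finite R A] [IsNoetherianRing A] (hm : IsCoatom m) [Module.Projective A m]
    (hS : ∀ f : m →ₗ[A] A ⧸ m, ∃ y : A ⧸ m, ∀ p : m, f p = (p : A) • y)
    (X : Type u) [AddCommGroup X] [Module A X] [Module.Finite A X] :
    ∃ (L : Type u) (_ : AddCommGroup L) (_ : Module A L) (_ : Module.Finite A L) (η : X →ₗ[A] L),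
      IsLocal m L ∧
      (∀ (Y : Type u) [AddCommGroup Y] [Module A Y], IsLocal m Y → ∀ φ : X →ₗ[A] Y,
        ∃! ψ : L →ₗ[A] Y, ψ ∘ₗ η = φ) ∧
      LinearMap.ker η ≤ tors m X ∧ tors m (L ⧸ LinearMap.range η) = ⊤ := by
  obtain ⟨n, f, hf⟩ := exists_generators (R := R) (IsNoetherian.noetherian m) X
  let ρ : (Fin n → m) →ₗ[A] X × (Fin n → A) :=
    LinearMap.prod (∑ j, f j ∘ₗ LinearMap.proj j) (-(LinearMap.pi fun j => m.subtype ∘ₗ LinearMap.proj j))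
  have hρ1 : ∀ q, (ρ q).1 = ∑ j, f j (q j) := fun q => by simp [ρ]
  have hρ2 : ∀ q j, (ρ q).2 j = -(q j : A) := fun q j => by simp [ρ]
  let N := LinearMap.range ρ
  let X' := (X × (Fin n → A)) ⧸ N
  let mk' : X × (Fin n → A) →ₗ[A] X' := N.mkQ
  have hmk' : Function.Surjective mk' := N.mkQ_surjective
  -- the relation in `X'`
  have hrel : ∀ q : Fin n → m, mk' (∑ j, f j (q j), 0) = mk' (0, fun j => (q j : A)) := by
    intro q
    rw [← sub_eq_zero, ← map_sub]
    refine (Submodule.Quotient.mk_eq_zero _).2 ⟨q, ?_⟩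
    ext j
    · simp [hρ1]
    · simp [hρ2]
  have hinj : ∀ x : X, mk' (x, 0) = 0 → x = 0 := by
    intro x hx
    obtain ⟨q, hq⟩ := (Submodule.Quotient.mk_eq_zero _).1 hx
    have hq0 : ∀ j, q j = 0 := fun j => by
      have := hρ2 q j
      rw [hq] at this
      exact Subtype.ext (neg_eq_zero.1 this.symm)
    have := hρ1 q
    rw [hq] at this
    simpa [hq0] using this
  have hext' : ∀ g : m →ₗ[A] X', ∃ y : X', ∀ p : m, g p = (p : A) • y := by
    intro g
    let π : X × (Fin n → A) →ₗ[A] (Fin n → A ⧸ m) :=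
      (LinearMap.pi fun j => m.mkQ ∘ₗ LinearMap.proj j) ∘ₗ LinearMap.snd A X (Fin n → A)
    have hπ : ∀ z j, π z j = m.mkQ (z.2 j) := fun z j => rfl
    have hπN : N ≤ LinearMap.ker π := by
      rintro _ ⟨q, rfl⟩
      rw [LinearMap.mem_ker]
      funext j
      rw [hπ, hρ2]
      simp
    let π' : X' →ₗ[A] (Fin n → A ⧸ m) := N.liftQ π hπN
    have hπ' : ∀ z, π' (mk' z) = π z := fun z => rfl
    choose z hz using fun j => hS (LinearMap.proj j ∘ₗ π' ∘ₗ g)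
    choose b hb using fun j => m.mkQ_surjective (z j)
    let h : X' := mk' (0, b)
    let g1 : m →ₗ[A] X' := g - (LinearMap.toSpanSingleton A X' h).domRestrict m
    have hg1 : ∀ p, g1 p = g p - (p : A) • h := fun p => rfl
    have hg1' : ∀ p, g1 p ∈ LinearMap.ker π' := by
      intro p
      rw [LinearMap.mem_ker, hg1, map_sub, map_smul, sub_eq_zero]
      funext j
      rw [Pi.smul_apply, hπ', hπ, hb j, ← hz j p]
      rfl
    let ι : X →ₗ[A] LinearMap.ker π' := (mk' ∘ₗ LinearMap.inl A X _).codRestrict _ (by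
      intro x
      rw [LinearMap.mem_ker]
      funext j
      change m.mkQ 0 = 0
      simp)
    have hι : Function.Surjective ι := by
      rintro ⟨y, hy⟩
      obtain ⟨⟨x, a⟩, rfl⟩ := hmk' y
      have ha : ∀ j, a j ∈ m := fun j => by
        have := congrFun hy j
        rw [hπ', hπ] at this
        exact (Submodule.Quotient.mk_eq_zero _).1 this
      refine ⟨x + ∑ j, f j ⟨a j, ha j⟩, Subtype.ext ?_⟩
      change mk' (x + ∑ j, f j ⟨a j, ha j⟩, 0) = mk' (x, a)
      have h1 := hrel fun j => ⟨a j, ha j⟩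
      have e1 : (x + ∑ j, f j ⟨a j, ha j⟩, (0 : Fin n → A)) =
        (x, 0) + (∑ j, f j ⟨a j, ha j⟩, 0) := by simp
      have e2 : (x, a) = (x, 0) + ((0 : X), a) := by simp
      rw [e1, e2, map_add, map_add, h1]
    obtain ⟨g2, hg2⟩ := Module.projective_lifting_property ι (g1.codRestrict _ hg1') hι
    obtain ⟨c, hc, hcg⟩ := hf g2
    refine ⟨h + mk' (0, c), fun p => ?_⟩
    have h1 : mk' (g2 p, 0) = g1 p := congrArg Subtype.val (LinearMap.congr_fun hg2 p)
    have h2 := hrel fun j => c j • p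
    have h3 : mk' (g2 p, 0) = (p : A) • mk' (0, c) := by
      rw [hcg p, ← map_smul]
      simp only [map_smul] at h2
      rw [h2]
      congr 1
      ext j
      · simp
      · simp [hc]
    rw [smul_add, ← h3, h1, hg1]
    abel
  let T : Submodule A X' := tors m X'
  have hextT : ∀ g : m →ₗ[A] T, ∃ y : T, ∀ p : m, g p = (p : A) • y := by
    intro g
    obtain ⟨s, hs, hsT⟩ := (Submodule.fg_span_iff_fg_span_finset_subset _).1
      (IsNoetherian.noetherian T)
    have hk : ∀ x : s, m ≤ LinearMap.ker (LinearMap.toSpanSingleton A X' (x : X')) :=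
      fun x p hp => hs x.2 p hp
    let Φ : (s → A ⧸ m) →ₗ[A] X' :=
      ∑ x : s, (m.liftQ (LinearMap.toSpanSingleton A X' (x : X')) (hk x)) ∘ₗ LinearMap.proj x
    have hΦ : ∀ w, Φ w = ∑ x : s, m.liftQ (LinearMap.toSpanSingleton A X' (x : X')) (hk x) (w x) :=
      fun w => by simp [Φ]
    have hΦT : ∀ w, Φ w ∈ T := fun w => by
      rw [hΦ]
      refine Submodule.sum_mem _ fun x _ => ?_
      obtain ⟨a, ha⟩ := m.mkQ_surjective (w x)
      rw [← ha]
      exact T.smul_mem a (Submodule.subset_span (hs x.2))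
    let Φ' : (s → A ⧸ m) →ₗ[A] T := Φ.codRestrict T hΦT
    have hΦ' : Function.Surjective Φ' := by
      rintro ⟨t, ht⟩
      have ht' : t ∈ Submodule.span A (s : Set X') := hsT ▸ ht
      obtain ⟨c, hc⟩ := Submodule.mem_span_finset'.1 ht'
      refine ⟨fun x => m.mkQ (c x), Subtype.ext ?_⟩
      change Φ _ = t
      rw [hΦ, ← hc]
      rfl
    obtain ⟨g', hg'⟩ := Module.projective_lifting_property Φ' g hΦ'
    choose y hy using fun x : s => hS (LinearMap.proj x ∘ₗ g')
    refine ⟨Φ' y, fun p => ?_⟩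
    rw [← hg', LinearMap.comp_apply, ← map_smul]
    congr 1
    funext x
    exact hy x p
  refine ⟨X' ⧸ T, inferInstance, inferInstance, inferInstance,
    T.mkQ ∘ₗ mk' ∘ₗ LinearMap.inl A X _, ⟨?_, ?_⟩, ?_, ?_, ?_⟩
  · intro y hy
    obtain ⟨x, rfl⟩ := T.mkQ_surjective y
    have hx : ∀ p : m, (p : A) • x ∈ T := fun p =>
      (Submodule.Quotient.mk_eq_zero _).1 (hy p p.2)
    obtain ⟨t, ht⟩ := hextT (((LinearMap.toSpanSingleton A X' x).domRestrict m).codRestrict T hx)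
    have : x - t ∈ T := Submodule.subset_span fun p hp => by
      have h := congrArg Subtype.val (ht ⟨p, hp⟩)
      change p • x = p • (t : X') at h
      rw [smul_sub, h, sub_self]
    have hxT : x ∈ T := by simpa using T.add_mem this t.2
    exact (Submodule.Quotient.mk_eq_zero _).2 hxT
  · intro g
    obtain ⟨g', hg'⟩ := Module.projective_lifting_property T.mkQ g T.mkQ_surjective
    obtain ⟨y, hy⟩ := hext' g'
    exact ⟨T.mkQ y, fun p => by rw [← hg', LinearMap.comp_apply, hy, map_smul]⟩
  · intro Y _ _ hY φ
    choose y hy using fun j => hY.ext (φ ∘ₗ f j)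
    let ψ0 : X × (Fin n → A) →ₗ[A] Y :=
      φ.coprod (∑ j, LinearMap.toSpanSingleton A Y (y j) ∘ₗ LinearMap.proj j)
    have hψ0 : ∀ x a, ψ0 (x, a) = φ x + ∑ j, a j • y j := fun x a => by simp [ψ0]
    have hN : N ≤ LinearMap.ker ψ0 := by
      rintro _ ⟨q, rfl⟩
      rw [LinearMap.mem_ker, show ρ q = ((ρ q).1, (ρ q).2) from rfl, hψ0, hρ1]
      simp only [hρ2, map_sum, neg_smul, Finset.sum_neg_distrib]
      rw [← sub_eq_add_neg, sub_eq_zero]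
      exact Finset.sum_congr rfl fun j _ => hy j (q j)
    let ψ1 : X' →ₗ[A] Y := N.liftQ ψ0 hN
    have hT : T ≤ LinearMap.ker ψ1 := by
      intro t ht
      have := map_tors ψ1 ht
      rwa [tors_eq_bot hY] at this
    refine ⟨T.liftQ ψ1 hT, ?_, ?_⟩
    · ext x
      change ψ0 (x, 0) = φ x
      simp [hψ0]
    · intro ψ hψ
      have key : ∀ z, ψ (T.mkQ (mk' z)) = ψ0 z := by
        have h0 : ∀ x, ψ (T.mkQ (mk' (x, 0))) = φ x := fun x => LinearMap.congr_fun hψ x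
        have h1 : ∀ j, ψ (T.mkQ (mk' (0, Pi.single j 1))) = y j := by
          intro j
          rw [← sub_eq_zero]
          refine hY.sep _ fun p hp => ?_
          have h2 := hrel (Pi.single j ⟨p, hp⟩)
          have h3 : ∑ i, f i ((Pi.single j ⟨p, hp⟩ : Fin n → m) i) = f j ⟨p, hp⟩ := by
            rw [Finset.sum_eq_single j]
            · simp
            · intro i _ hij; simp [Pi.single_eq_of_ne hij]
            · simp
          have h4 : (fun i => (((Pi.single j ⟨p, hp⟩ : Fin n → m) i : m) : A)) =
              p • (Pi.single j 1 : Fin n → A) := by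
            funext i
            by_cases hij : i = j
            · subst hij; simp
            · simp [Pi.single_eq_of_ne hij]
          rw [h3, h4] at h2
          have h5 : ((0 : X), p • (Pi.single j 1 : Fin n → A)) =
            p • ((0 : X), (Pi.single j 1 : Fin n → A)) := by simp
          rw [smul_sub, ← map_smul, ← map_smul, ← map_smul, ← h5, ← h2, h0, sub_eq_zero]
          exact hy j ⟨p, hp⟩
        rintro ⟨x, a⟩
        have e : (x, a) = (x, (0 : Fin n → A)) +
            ∑ j, a j • ((0 : X), (Pi.single j 1 : Fin n → A)) := by
          ext i
          · simp [Prod.fst_sum]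
          · simp [Prod.snd_sum, Finset.sum_apply, Pi.single_apply]
        rw [hψ0]
        conv_lhs => rw [e]
        simp only [map_add, map_sum, map_smul, h0, h1]
      refine LinearMap.ext fun w => ?_
      obtain ⟨z, rfl⟩ := T.mkQ_surjective w
      obtain ⟨z, rfl⟩ := hmk' z
      rw [key]
      rfl
  · intro x hx
    have hx' : (mk' ∘ₗ LinearMap.inl A X _) x ∈ T := (Submodule.Quotient.mk_eq_zero _).1 hx
    refine mem_tors_of_injective hm (mk' ∘ₗ LinearMap.inl A X _) ?_ hx'
    rw [← LinearMap.ker_eq_bot, eq_bot_iff]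
    exact fun z hz => hinj z hz
  · rw [eq_top_iff]
    rintro w -
    obtain ⟨w, rfl⟩ := Submodule.mkQ_surjective _ w
    obtain ⟨w, rfl⟩ := T.mkQ_surjective w
    obtain ⟨⟨x, a⟩, rfl⟩ := hmk' w
    have e : (x, a) = (x, (0 : Fin n → A)) +
        ∑ j, a j • ((0 : X), (Pi.single j 1 : Fin n → A)) := by
      ext i
      · simp [Prod.fst_sum]
      · simp [Prod.snd_sum, Finset.sum_apply, Pi.single_apply]
    rw [e]
    simp only [map_add, map_sum, map_smul]
    refine Submodule.add_mem _ ?_ (Submodule.sum_mem _ fun j _ => Submodule.smul_mem _ _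
      (Submodule.subset_span fun p hp => ?_))
    · have : (Submodule.mkQ (LinearMap.range (T.mkQ ∘ₗ mk' ∘ₗ LinearMap.inl A X (Fin n → A))))
          (T.mkQ (mk' (x, 0))) = 0 := (Submodule.Quotient.mk_eq_zero _).2 ⟨x, rfl⟩
      rw [this]
      exact Submodule.zero_mem _
    · rw [← map_smul, ← map_smul, ← map_smul]
      refine (Submodule.Quotient.mk_eq_zero _).2 ⟨f j ⟨p, hp⟩, ?_⟩
      change T.mkQ (mk' (f j ⟨p, hp⟩, 0)) = _
      have h2 := hrel (Pi.single j ⟨p, hp⟩)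
      have h3 : ∑ i, f i ((Pi.single j ⟨p, hp⟩ : Fin n → m) i) = f j ⟨p, hp⟩ := by
        rw [Finset.sum_eq_single j]
        · simp
        · intro i _ hij; simp [Pi.single_eq_of_ne hij]
        · simp
      have h4 : (fun i => (((Pi.single j ⟨p, hp⟩ : Fin n → m) i : m) : A)) =
          p • (Pi.single j 1 : Fin n → A) := by
        funext i
        by_cases hij : i = j
        · subst hij; simp
        · simp [Pi.single_eq_of_ne hij]
      rw [h3, h4] at h2
      rw [h2]
      simp

end LocalModules

section Setting

/-- An artin algebra: a ring which is a finitely generated module over some commutative artinian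
ring acting centrally. -/
class IsArtinAlgebra (A : Type u) [Ring A] : Prop where
  exists_finite : ∃ (R : Type u) (_ : CommRing R) (_ : Algebra R A),
    IsArtinianRing R ∧ Module.Finite R A

/-- The base ring may live in any universe. -/
theorem IsArtinAlgebra.of_finite (R : Type v) [CommRing R] [IsArtinianRing R] (A : Type u) [Ring A]
    [Algebra R A] [Module.Finite R A] : IsArtinAlgebra A := by
  let R' := (algebraMap R A).range
  have hcomm : ∀ (x : R') (a : A), (x : A) * a = a * x := by
    rintro ⟨_, r, rfl⟩ a
    exact Algebra.commutes r a
  let cR : CommRing R' := { (inferInstance : Ring R') with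
    mul_comm := fun x y => Subtype.ext (hcomm x y) }
  let aR : Algebra R' A := RingHom.toAlgebra' R'.subtype hcomm
  let φ : R →+* R' := (algebraMap R A).rangeRestrict
  refine ⟨R', cR, aR, (algebraMap R A).rangeRestrict_surjective.isArtinianRing (f := φ), ?_⟩
  obtain ⟨s, hs⟩ := Module.Finite.fg_top (R := R) (M := A)
  refine ⟨s, eq_top_iff.2 fun x _ => ?_⟩
  have hx : x ∈ Submodule.span R (s : Set A) := hs ▸ Submodule.mem_top
  induction hx using Submodule.span_induction with
  | mem x hx => exact Submodule.subset_span hx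
  | zero => exact Submodule.zero_mem _
  | add x y _ _ h1 h2 => exact Submodule.add_mem _ (h1 trivial) (h2 trivial)
  | smul r x _ h1 =>
    rw [Algebra.smul_def]
    exact Submodule.smul_mem _ (φ r) (h1 trivial)

instance (A : Type u) [Ring A] [h : IsArtinAlgebra A] : IsNoetherianRing A := by
  obtain ⟨R, _, _, _, _⟩ := h.exists_finite
  have : IsNoetherian R A := isNoetherian_of_isNoetherianRing_of_finite R A
  exact isNoetherian_of_tower R this

variable {A : Type u} [Ring A]

/-- A localizable module: a simple module `S` with projective dimension at most one and
`Ext¹(S, S) = 0`. -/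
class IsLocalizable (S : ModuleCat.{u} A) : Prop where
  isSimpleModule : IsSimpleModule A S
  hasProjectiveDimensionLE : HasProjectiveDimensionLE S 1
  subsingleton_ext : Subsingleton (Abelian.Ext S S 1)

/-- The perpendicular subcategory `S^⊥` of the category of finitely generated `A`-modules. -/
def perp (S : ModuleCat.{u} A) : ObjectProperty (FGModuleCat.{u} A) := fun X =>
  Subsingleton (S ⟶ X.obj) ∧ Subsingleton (Abelian.Ext S X.obj 1)

theorem subsingleton_hom_iff {m : Submodule A A} {S : ModuleCat.{u} A} (e : S ≃ₗ[A] A ⧸ m)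
    (Y : ModuleCat.{u} A) :
    Subsingleton (S ⟶ Y) ↔ ∀ y : Y, (∀ p ∈ m, p • y = 0) → y = 0 := by
  constructor
  · intro h y hy
    let f : S →ₗ[A] Y := m.liftQ (LinearMap.toSpanSingleton A Y y) (fun p hp => hy p hp) ∘ₗ e
    have h0 : ModuleCat.ofHom f = 0 := h.elim _ _
    have h1 : f (e.symm (m.mkQ 1)) = 0 := LinearMap.congr_fun (congrArg ModuleCat.Hom.hom h0) _
    have h2 : f (e.symm (m.mkQ 1)) = (1 : A) • y := by
      simp only [f, LinearMap.comp_apply, LinearEquiv.coe_coe, e.apply_symm_apply]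
      rfl
    rwa [h2, one_smul] at h1
  · intro h
    refine ⟨fun f g => ?_⟩
    suffices H : ∀ f : S ⟶ Y, f = 0 by rw [H f, H g]
    intro f
    have h0 : f.hom (e.symm (m.mkQ 1)) = 0 := h _ fun p hp => by
      rw [← map_smul, ← map_smul, ← map_smul]
      have : m.mkQ (p • 1) = 0 := (Submodule.Quotient.mk_eq_zero _).2 (by simpa using hp)
      rw [this, map_zero, map_zero]
    ext s
    obtain ⟨a, ha⟩ := m.mkQ_surjective (e s)
    have : s = a • e.symm (m.mkQ 1) := by
      rw [← map_smul, ← map_smul, smul_eq_mul, mul_one, ha, e.symm_apply_apply]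
    rw [this, map_smul, h0]
    simp

/-- The short exact sequence `0 → m → A → S → 0`. -/
def simpleSeq {m : Submodule A A} {S : ModuleCat.{u} A} (e : S ≃ₗ[A] A ⧸ m) :
    ShortComplex (ModuleCat.{u} A) where
  X₁ := ModuleCat.of A m
  X₂ := ModuleCat.of A A
  X₃ := S
  f := ModuleCat.ofHom m.subtype
  g := ModuleCat.ofHom (e.symm.toLinearMap ∘ₗ m.mkQ)
  zero := by ext x; simp

theorem simpleSeq_shortExact {m : Submodule A A} {S : ModuleCat.{u} A} (e : S ≃ₗ[A] A ⧸ m) :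
    (simpleSeq e).ShortExact where
  exact := by
    rw [ShortComplex.moduleCat_exact_iff]
    intro a ha
    have h : e.symm (m.mkQ a) = 0 := ha
    rw [LinearEquiv.map_eq_zero_iff] at h
    exact ⟨⟨a, (Submodule.Quotient.mk_eq_zero _).1 h⟩, rfl⟩
  mono_f := (ModuleCat.mono_iff_injective _).2 m.subtype_injective
  epi_g := (ModuleCat.epi_iff_surjective _).2 (e.symm.surjective.comp m.mkQ_surjective)

theorem projective_of_simpleSeq {m : Submodule A A} {S : ModuleCat.{u} A} (e : S ≃ₗ[A] A ⧸ m)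
    [HasProjectiveDimensionLE S 1] : Module.Projective A m := by
  have h : HasProjectiveDimensionLT (ModuleCat.of A m) 1 :=
    (simpleSeq_shortExact e).hasProjectiveDimensionLT_X₁ 1
      (inferInstanceAs (HasProjectiveDimensionLT (ModuleCat.of A A) 1))
      (inferInstanceAs (HasProjectiveDimensionLE S 1))
  have : Projective (ModuleCat.of A m) := inferInstance
  exact (IsProjective.iff_projective (R := A) m).2 this

theorem subsingleton_ext_iff {m : Submodule A A} {S : ModuleCat.{u} A} (e : S ≃ₗ[A] A ⧸ m)
    (Y : ModuleCat.{u} A) : Subsingleton (Abelian.Ext S Y 1) ↔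
      ∀ f : m →ₗ[A] Y, ∃ y : Y, ∀ p : m, f p = (p : A) • y := by
  have hS := simpleSeq_shortExact e
  constructor
  · intro h f
    have h0 : hS.extClass.comp (Abelian.Ext.mk₀ (ModuleCat.ofHom f)) (add_zero 1) = 0 :=
      h.elim _ _
    obtain ⟨x, hx⟩ := Abelian.Ext.contravariant_sequence_exact₁ hS Y
      (Abelian.Ext.mk₀ (ModuleCat.ofHom f)) (add_zero 1) h0
    obtain ⟨g, rfl⟩ := Abelian.Ext.homEquiv₀.symm.surjective x
    rw [Abelian.Ext.homEquiv₀_symm_apply, Abelian.Ext.mk₀_comp_mk₀] at hx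
    have hx' := Abelian.Ext.homEquiv₀.symm.injective hx
    refine ⟨g.hom (1 : A), fun p => ?_⟩
    have h1 := LinearMap.congr_fun (congrArg ModuleCat.Hom.hom hx') p
    change g.hom (p : A) = f p at h1
    have h2 : g.hom ((p : A) • (1 : A)) = (p : A) • g.hom (1 : A) := g.hom.map_smul _ _
    rw [← h1, ← h2, smul_eq_mul, mul_one]
  · intro h
    refine ⟨fun x y => ?_⟩
    suffices H : ∀ x : Abelian.Ext S Y 1, x = 0 by rw [H x, H y]
    intro x
    have hP : Projective (simpleSeq e).X₂ := inferInstanceAs (Projective (ModuleCat.of A A))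
    obtain ⟨z, hz⟩ := Abelian.Ext.contravariant_sequence_exact₃ hS Y x
      (Abelian.Ext.eq_zero_of_hasProjectiveDimensionLT _ 1 le_rfl) (add_zero 1)
    obtain ⟨f, rfl⟩ := Abelian.Ext.homEquiv₀.symm.surjective z
    obtain ⟨y, hy⟩ := h f.hom
    obtain ⟨g, hf⟩ : ∃ g : (simpleSeq e).X₂ ⟶ Y, f = (simpleSeq e).f ≫ g := by
      refine ⟨ModuleCat.ofHom (LinearMap.toSpanSingleton A Y y), ?_⟩
      ext p
      exact hy p
    rw [← hz, Abelian.Ext.homEquiv₀_symm_apply, hf, ← Abelian.Ext.mk₀_comp_mk₀]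
    exact hS.extClass_comp_assoc _

theorem perp_iff {m : Submodule A A} {S : ModuleCat.{u} A} (e : S ≃ₗ[A] A ⧸ m)
    (X : FGModuleCat.{u} A) : perp S X ↔ IsLocal m X := by
  rw [perp, subsingleton_hom_iff e, subsingleton_ext_iff e]
  exact ⟨fun h => ⟨h.1, h.2⟩, fun h => ⟨h.1, h.2⟩⟩

end Setting

section Reflection

variable {A : Type u} [Ring A] (S : ModuleCat.{u} A) [hS : IsLocalizable S]

theorem exists_maximal : ∃ m : Submodule A A, IsCoatom m ∧ Module.Projective A m ∧
    (∀ f : m →ₗ[A] A ⧸ m, ∃ y : A ⧸ m, ∀ p : m, f p = (p : A) • y) ∧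
    ∀ X : FGModuleCat.{u} A, perp S X ↔ IsLocal m X := by
  obtain ⟨m, hm, ⟨e⟩⟩ := isSimpleModule_iff_quot_maximal.1 hS.isSimpleModule
  have := hS.hasProjectiveDimensionLE
  refine ⟨m, hm.out, projective_of_simpleSeq e, fun f => ?_, perp_iff e⟩
  obtain ⟨y, hy⟩ := (subsingleton_ext_iff e S).1 hS.subsingleton_ext (e.symm.toLinearMap ∘ₗ f)
  refine ⟨e y, fun p => ?_⟩
  rw [← map_smul, ← hy p]
  simp

variable [IsArtinAlgebra A]

/-- Every finitely generated module has a universal morphism to `S^⊥`. -/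
theorem exists_universal (X : FGModuleCat.{u} A) : ∃ (L : (perp S).FullSubcategory)
    (η : X ⟶ L.obj), (∀ (Y : (perp S).FullSubcategory) (φ : X ⟶ Y.obj), ∃! ψ : L ⟶ Y,
      η ≫ ψ.hom = φ) ∧ LinearMap.ker η.hom.hom ≤ tors (exists_maximal S).choose X ∧
      tors (exists_maximal S).choose (L.obj ⧸ LinearMap.range η.hom.hom) = ⊤ := by
  obtain ⟨hm, hP, hmm, hperp⟩ := (exists_maximal S).choose_spec
  obtain ⟨R, _, _, _, _⟩ := IsArtinAlgebra.exists_finite (A := A)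
  obtain ⟨L, _, _, _, η, hL, hη, hker, hcok⟩ := exists_reflection (R := R) hm hmm X
  refine ⟨⟨FGModuleCat.of A L, (hperp _).2 hL⟩, FGModuleCat.ofHom η, fun Y φ => ?_, hker, hcok⟩
  obtain ⟨ψ, h1, h2⟩ := hη Y.obj ((hperp _).1 Y.property) φ.hom.hom
  refine ⟨ObjectProperty.homMk (FGModuleCat.ofHom ψ), FGModuleCat.hom_ext h1, fun ψ' h => ?_⟩
  have := h2 ψ'.hom.hom.hom (congrArg (fun f => f.hom.hom) h)
  ext x
  exact LinearMap.congr_fun this x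

/-- The universal morphisms assemble into a bijection on morphisms. -/
def reflEquiv (X : FGModuleCat.{u} A) (Y : (perp S).FullSubcategory) :
    ((exists_universal S X).choose ⟶ Y) ≃ (X ⟶ (perp S).ι.obj Y) :=
  Equiv.ofBijective (fun ψ => (exists_universal S X).choose_spec.choose ≫ ψ.hom)
    ((Function.bijective_iff_existsUnique _).2 fun φ =>
      (exists_universal S X).choose_spec.choose_spec.1 Y φ)

/-- The left adjoint `i_λ` of the inclusion `i : S^⊥ → A-mod`, sending a module to the target of
its universal morphism to `S^⊥`. -/
def iLambda : FGModuleCat.{u} A ⥤ (perp S).FullSubcategory :=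
  Adjunction.leftAdjointOfEquiv (G := (perp S).ι) (reflEquiv S) fun _ _ _ _ _ => by
    simp [reflEquiv]

/-- The adjunction between `i_λ` and the inclusion `i`. -/
def iLambdaAdj : iLambda S ⊣ (perp S).ι :=
  Adjunction.adjunctionOfEquivLeft (G := (perp S).ι) (reflEquiv S) fun _ _ _ _ _ => by
    simp [reflEquiv]

/-- The localization functor `L = i i_λ`. -/
abbrev locFunctor : FGModuleCat.{u} A ⥤ FGModuleCat.{u} A := iLambda S ⋙ (perp S).ι

/-- The unit `η : Id → L`. -/
abbrev locUnit : 𝟭 (FGModuleCat.{u} A) ⟶ locFunctor S := (iLambdaAdj S).unit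

end Reflection

section Algebra

variable {A : Type u} [Ring A] [IsArtinAlgebra A] (S : ModuleCat.{u} A) [IsLocalizable S]

/-- The underlying type of the algebra `L(A)`: that of the `A`-module `L(A)`, the localization of
the regular module `A`. -/
def LAlg : Type u := (locFunctor S).obj (FGModuleCat.of A A)

instance : AddCommGroup (LAlg S) :=
  inferInstanceAs (AddCommGroup ((locFunctor S).obj (FGModuleCat.of A A)))

instance : Module A (LAlg S) :=
  inferInstanceAs (Module A ((locFunctor S).obj (FGModuleCat.of A A)))

instance : Module.Finite A (LAlg S) :=
  inferInstanceAs (Module.Finite A ((locFunctor S).obj (FGModuleCat.of A A)))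

/-- The morphism `η_A : A → L(A)` of `A`-modules. -/
def etaLin : A →ₗ[A] LAlg S := ((locUnit S).app (FGModuleCat.of A A)).hom.hom

/-- For `y` in a module `Y` of `S^⊥`, the unique extension `L(A) → Y` along `η_A` of the
morphism `r_y : A → Y`, `a ↦ a • y`. -/
def extend (Y : (perp S).FullSubcategory) (y : Y.obj) : LAlg S →ₗ[A] Y.obj :=
  (((iLambdaAdj S).homEquiv (FGModuleCat.of A A) Y).symm
    (FGModuleCat.ofHom (LinearMap.toSpanSingleton A Y.obj y))).hom.hom.hom

theorem extend_comp_eta (Y : (perp S).FullSubcategory) (y : Y.obj) :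
    extend S Y y ∘ₗ etaLin S = LinearMap.toSpanSingleton A Y.obj y := by
  have h := ((iLambdaAdj S).homEquiv (FGModuleCat.of A A) Y).apply_symm_apply
    (FGModuleCat.ofHom (LinearMap.toSpanSingleton A Y.obj y))
  rw [Adjunction.homEquiv_unit] at h
  exact congrArg (fun f => f.hom.hom) h

theorem extend_eta (Y : (perp S).FullSubcategory) (y : Y.obj) (a : A) :
    extend S Y y (etaLin S a) = a • y :=
  LinearMap.congr_fun (extend_comp_eta S Y y) a

theorem hom_ext_eta (Y : (perp S).FullSubcategory) {g h : LAlg S →ₗ[A] Y.obj}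
    (H : g (etaLin S 1) = h (etaLin S 1)) : g = h := by
  let g' : (iLambda S).obj (FGModuleCat.of A A) ⟶ Y := ObjectProperty.homMk (FGModuleCat.ofHom g)
  let h' : (iLambda S).obj (FGModuleCat.of A A) ⟶ Y := ObjectProperty.homMk (FGModuleCat.ofHom h)
  have : g' = h' := by
    apply ((iLambdaAdj S).homEquiv (FGModuleCat.of A A) Y).injective
    rw [Adjunction.homEquiv_unit, Adjunction.homEquiv_unit]
    refine FGModuleCat.hom_ext (LinearMap.ext_ring ?_)
    exact H
  exact congrArg (fun f => f.hom.hom.hom) this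

theorem eq_extend (Y : (perp S).FullSubcategory) (g : LAlg S →ₗ[A] Y.obj) :
    g = extend S Y (g (etaLin S 1)) :=
  hom_ext_eta S Y (by rw [extend_eta, one_smul])

/-- `L(A)` as an object of `S^⊥`. -/
abbrev LObj : (perp S).FullSubcategory := (iLambda S).obj (FGModuleCat.of A A)

/-- The product `x ⋆ y` on `L(A)`: apply to `x` the endomorphism of `L(A)` extending `r_y`. -/
def starMul (x y : LAlg S) : LAlg S := extend S (LObj S) y x

/-- The product is given by `x ⋆ y = L(η_A)⁻¹(L(r_y)(x))`. -/
theorem locFunctor_map_star (x y : LAlg S) :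
    ((locFunctor S).map ((locUnit S).app (FGModuleCat.of A A))).hom.hom (starMul S x y) =
      ((locFunctor S).map (Y := (locFunctor S).obj (FGModuleCat.of A A)) (FGModuleCat.ofHom
        (LinearMap.toSpanSingleton A (LAlg S) y))).hom.hom x := by
  let R := FGModuleCat.of A A
  let r : R ⟶ (locFunctor S).obj R := FGModuleCat.ofHom (LinearMap.toSpanSingleton A (LAlg S) y)
  let e : (iLambda S).obj R ⟶ (iLambda S).obj R := ((iLambdaAdj S).homEquiv R _).symm r
  have hr : (locUnit S).app R ≫ (perp S).ι.map e = r := by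
    have h := ((iLambdaAdj S).homEquiv R _).apply_symm_apply r
    rwa [Adjunction.homEquiv_unit] at h
  have h1 : (locFunctor S).map ((locUnit S).app R) = (locUnit S).app ((locFunctor S).obj R) := by
    have h2 : (iLambda S).map ((locUnit S).app R) = ObjectProperty.homMk
        ((locUnit S).app ((locFunctor S).obj R)) := by
      apply ((iLambdaAdj S).homEquiv R _).injective
      rw [Adjunction.homEquiv_unit, Adjunction.homEquiv_unit]
      exact ((locUnit S).naturality ((locUnit S).app R)).symm
    exact congrArg (fun f => f.hom) h2
  have h3 : (perp S).ι.map e ≫ (locFunctor S).map ((locUnit S).app R) = (locFunctor S).map r := by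
    rw [← hr, Functor.map_comp, h1]
    exact (locUnit S).naturality ((perp S).ι.map e)
  exact LinearMap.congr_fun (congrArg (fun f => f.hom.hom) h3) x

theorem extend_star (Y : (perp S).FullSubcategory) (y : Y.obj) (x z : LAlg S) :
    extend S Y y (starMul S x z) = extend S Y (extend S Y y z) x := by
  have : extend S Y y ∘ₗ extend S (LObj S) z = extend S Y (extend S Y y z) :=
    hom_ext_eta S Y ((congrArg (extend S Y y) ((extend_eta S (LObj S) z 1).trans
      (one_smul A _))).trans ((extend_eta S Y _ 1).trans (one_smul A _)).symm)
  exact LinearMap.congr_fun this x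

theorem extend_add (Y : (perp S).FullSubcategory) (y z : Y.obj) :
    extend S Y (y + z) = extend S Y y + extend S Y z :=
  hom_ext_eta S Y (by simp only [LinearMap.add_apply, extend_eta, one_smul])

theorem extend_zero (Y : (perp S).FullSubcategory) : extend S Y 0 = 0 :=
  hom_ext_eta S Y (by simp only [LinearMap.zero_apply, extend_eta, one_smul])

theorem extend_eta_one : extend S (LObj S) (etaLin S 1) = LinearMap.id :=
  hom_ext_eta S (LObj S) ((extend_eta S (LObj S) _ 1).trans (one_smul A _))

/-- The ring structure on `L(A)` with product `⋆`. -/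
instance : Ring (LAlg S) :=
  { (inferInstance : AddCommGroup (LAlg S)) with
    mul := starMul S
    one := etaLin S 1
    left_distrib := fun x y z => LinearMap.congr_fun (extend_add S (LObj S) y z) x
    right_distrib := fun x y z => map_add (extend S (LObj S) z) x y
    zero_mul := fun x => map_zero (extend S (LObj S) x)
    mul_zero := fun x => LinearMap.congr_fun (extend_zero S (LObj S)) x
    mul_assoc := fun x y z => extend_star S (LObj S) z x y
    one_mul := fun x => (extend_eta S (LObj S) x 1).trans (one_smul A _)
    mul_one := fun x => LinearMap.congr_fun (extend_eta_one S) x }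

theorem mul_def (x y : LAlg S) : x * y = starMul S x y := rfl

theorem etaLin_mul (a : A) (y : LAlg S) : etaLin S a * y = a • y := extend_eta S (LObj S) y a

/-- The left retraction `η_A : A → L(A)` associated to `S`, a ring homomorphism. -/
def retraction : A →+* LAlg S where
  toFun := etaLin S
  map_one' := rfl
  map_mul' a b := by rw [etaLin_mul, ← smul_eq_mul, map_smul]
  map_zero' := map_zero _
  map_add' := map_add _

theorem retraction_mul (a : A) (y : LAlg S) : retraction S a * y = a • y := etaLin_mul S a y

instance : IsArtinAlgebra (LAlg S) := by
  obtain ⟨R, _, _, hR, hA⟩ := IsArtinAlgebra.exists_finite (A := A)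
  have hcomm : ∀ (r : R) (y : LAlg S), ((retraction S).comp (algebraMap R A)) r * y =
      y * ((retraction S).comp (algebraMap R A)) r := by
    intro r y
    let g : LAlg S →ₗ[A] LAlg S :=
      { toFun := fun x => algebraMap R A r • x
        map_add' := fun x y => smul_add _ x y
        map_smul' := fun a x => by
          rw [RingHom.id_apply, smul_smul, smul_smul, Algebra.commutes] }
    have h : extend S (LObj S) (etaLin S (algebraMap R A r)) = g :=
      hom_ext_eta S (LObj S) (((extend_eta S (LObj S) _ 1).trans (one_smul A _)).trans (by
        change _ = algebraMap R A r • etaLin S 1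
        rw [← map_smul, smul_eq_mul, mul_one]))
    exact (etaLin_mul S _ y).trans (LinearMap.congr_fun h y).symm
  let aR : Algebra R (LAlg S) := RingHom.toAlgebra' ((retraction S).comp (algebraMap R A)) hcomm
  have : IsScalarTower R A (LAlg S) := ⟨fun r a x => by
    rw [Algebra.smul_def, Algebra.smul_def, mul_smul]
    exact (etaLin_mul S _ _).symm⟩
  exact ⟨R, inferInstance, aR, hR, Module.Finite.trans A (LAlg S)⟩

end Algebra

section Identification

variable {A : Type u} [Ring A] [IsArtinAlgebra A] (S : ModuleCat.{u} A) [IsLocalizable S]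

/-- The canonical `L(A)`-module structure on a module of `S^⊥`. -/
@[reducible]
def perpModule (Y : (perp S).FullSubcategory) : Module (LAlg S) Y.obj where
  smul x y := extend S Y y x
  one_smul y := (extend_eta S Y y 1).trans (one_smul A y)
  mul_smul x z y := extend_star S Y y x z
  smul_zero x := LinearMap.congr_fun (extend_zero S Y) x
  smul_add x y z := LinearMap.congr_fun (extend_add S Y y z) x
  add_smul x z y := map_add (extend S Y y) x z
  zero_smul y := map_zero (extend S Y y)

theorem perpModule_smul_def (Y : (perp S).FullSubcategory) (x : LAlg S) (y : Y.obj) :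
    letI := perpModule S Y
    x • y = extend S Y y x := rfl

theorem finite_perpModule (Y : (perp S).FullSubcategory) :
    letI := perpModule S Y
    Module.Finite (LAlg S) Y.obj := by
  let _ := perpModule S Y
  obtain ⟨s, hs⟩ := Module.Finite.fg_top (R := A) (M := Y.obj)
  refine ⟨s, eq_top_iff.2 fun x _ => ?_⟩
  have hx : x ∈ Submodule.span A (s : Set Y.obj) := hs ▸ Submodule.mem_top
  induction hx using Submodule.span_induction with
  | mem x hx => exact Submodule.subset_span hx
  | zero => exact Submodule.zero_mem _
  | add x y _ _ h1 h2 => exact Submodule.add_mem _ (h1 trivial) (h2 trivial)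
  | smul a x _ h1 =>
    rw [← extend_eta S Y x a, ← perpModule_smul_def]
    exact Submodule.smul_mem _ _ (h1 trivial)

/-- The functor `S^⊥ → L(A)-mod` endowing a module of `S^⊥` with its canonical
`L(A)`-module structure. -/
def perpToLAlg : (perp S).FullSubcategory ⥤ FGModuleCat.{u} (LAlg S) where
  obj Y := letI := perpModule S Y; ⟨ModuleCat.of (LAlg S) Y.obj, finite_perpModule S Y⟩
  map {Y Z} f := letI := perpModule S Y; letI := perpModule S Z
    ObjectProperty.homMk (ModuleCat.ofHom
      { toFun := f.hom.hom.hom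
        map_add' := map_add f.hom.hom.hom
        map_smul' := fun x y => by
          have : f.hom.hom.hom ∘ₗ extend S Y y = extend S Z (f.hom.hom.hom y) :=
            hom_ext_eta S Z (by
              rw [LinearMap.comp_apply, extend_eta, extend_eta, one_smul, one_smul])
          exact LinearMap.congr_fun this x })

/-- The functor `i : L(A)-mod → A-mod`: restriction of scalars along `η_A`. -/
def iRes : FGModuleCat.{u} (LAlg S) ⥤ FGModuleCat.{u} A :=
  ObjectProperty.lift _ ((ModuleCat.isFG (LAlg S)).ι ⋙ ModuleCat.restrictScalars (retraction S))
    fun M => by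
      let _ : Module A M.obj := Module.compHom M.obj (retraction S)
      have : IsScalarTower A (LAlg S) M.obj := ⟨fun a x y => by
        rw [← retraction_mul, mul_smul]; rfl⟩
      have : Module.Finite (LAlg S) M.obj := M.property
      have : Module.Finite A M.obj := Module.Finite.trans (LAlg S) M.obj
      exact this

theorem iRes_smul (M : FGModuleCat.{u} (LAlg S)) (a : A) (y : (iRes S).obj M) :
    a • y = (show M from (retraction S a • (show M from y) : M)) := rfl

/-- Every finitely generated `L(A)`-module, seen as an `A`-module, lies in `S^⊥`. -/
theorem perp_iRes (M : FGModuleCat.{u} (LAlg S)) : perp S ((iRes S).obj M) := by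
  obtain ⟨m, hm, hP, hmm, hperp⟩ := exists_maximal S
  rw [hperp]
  have hL : IsLocal m (LAlg S) := (hperp _).1 (LObj S).property
  obtain ⟨n, q, hq⟩ := Module.Finite.exists_fin' (LAlg S) M
  have : Module.Finite (LAlg S) (LinearMap.ker q) :=
    Module.Finite.iff_fg.2 (IsNoetherian.noetherian _)
  obtain ⟨k, g, hg⟩ := Module.Finite.exists_fin' (LAlg S) (LinearMap.ker q)
  let q' : (Fin n → LAlg S) →ₗ[A] (iRes S).obj M :=
    { toFun := q
      map_add' := map_add q
      map_smul' := fun a x => by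
        have : a • x = retraction S a • x := funext fun i => (retraction_mul S a (x i)).symm
        rw [this, map_smul]
        rfl }
  let g' : (Fin k → LAlg S) →ₗ[A] (Fin n → LAlg S) :=
    { toFun := fun x => g x
      map_add' := fun x y => by rw [map_add]; rfl
      map_smul' := fun a x => by
        have : a • x = retraction S a • x := funext fun i => (retraction_mul S a (x i)).symm
        rw [this, map_smul]
        exact funext fun i => retraction_mul S a _ }
  refine isLocal_of_presentation (hL.pi (ι := Fin k)) (hL.pi (ι := Fin n)) g' q' hq ?_
  ext x
  constructor
  · intro hx
    obtain ⟨z, hz⟩ := hg ⟨x, hx⟩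
    exact ⟨z, congrArg Subtype.val hz⟩
  · rintro ⟨z, rfl⟩
    exact (g z).2

/-- Restriction of scalars as a functor `L(A)-mod → S^⊥`. -/
def lAlgToPerp : FGModuleCat.{u} (LAlg S) ⥤ (perp S).FullSubcategory :=
  (perp S).lift (iRes S) (perp_iRes S)

theorem extend_iRes (M : FGModuleCat.{u} (LAlg S)) (y : M) (x : LAlg S) :
    extend S ((lAlgToPerp S).obj M) y x = x • y := by
  let g : LAlg S →ₗ[A] (iRes S).obj M :=
    { toFun := fun x => x • y
      map_add' := fun x z => add_smul x z y
      map_smul' := fun a x => by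
        rw [← retraction_mul, mul_smul]
        rfl }
  have h : extend S ((lAlgToPerp S).obj M) y = g := hom_ext_eta S ((lAlgToPerp S).obj M)
    ((extend_eta S ((lAlgToPerp S).obj M) y 1).trans
      ((one_smul A (show (iRes S).obj M from y)).trans (one_smul (LAlg S) y).symm))
  exact LinearMap.congr_fun h x

/-- The equivalence `S^⊥ ≃ L(A)-mod`. -/
def perpEquivalence : (perp S).FullSubcategory ≌ FGModuleCat.{u} (LAlg S) where
  functor := perpToLAlg S
  inverse := lAlgToPerp S
  unitIso := NatIso.ofComponents (fun Y => (perp S).isoMk ((ModuleCat.isFG A).isoMk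
    (LinearEquiv.toModuleIso
    (show Y.obj.obj ≃ₗ[A] ((iRes S).obj ((perpToLAlg S).obj Y)).obj from
      { toFun := fun y => y
        invFun := fun y => y
        left_inv := fun _ => rfl
        right_inv := fun _ => rfl
        map_add' := fun _ _ => rfl
        map_smul' := fun a y => (extend_eta S Y y a).symm })))) fun _ => rfl
  counitIso := NatIso.ofComponents (fun M =>
    (ModuleCat.isFG (LAlg S)).isoMk (LinearEquiv.toModuleIso
    (show ((perpToLAlg S).obj ((lAlgToPerp S).obj M)).obj ≃ₗ[LAlg S] M.obj from
      { toFun := fun y => y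
        invFun := fun y => y
        left_inv := fun _ => rfl
        right_inv := fun _ => rfl
        map_add' := fun _ _ => rfl
        map_smul' := fun x y => extend_iRes S M y x }))) fun _ => rfl
  functor_unitIso_comp _ := rfl

/-- The functor `i_λ : A-mod → L(A)-mod`. -/
def iLambdaRes : FGModuleCat.{u} A ⥤ FGModuleCat.{u} (LAlg S) :=
  iLambda S ⋙ (perpEquivalence S).functor

/-- The adjunction between `i_λ : A-mod → L(A)-mod` and `i : L(A)-mod → A-mod`. -/
def iLambdaResAdj : iLambdaRes S ⊣ iRes S :=
  ((iLambdaAdj S).comp (perpEquivalence S).toAdjunction).ofNatIsoRight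
    (show lAlgToPerp S ⋙ (perp S).ι ≅ iRes S from (perp S).liftCompιIso (iRes S) (perp_iRes S))

end Identification

section Exactness

variable {A : Type u} [Ring A] [IsArtinAlgebra A] (S : ModuleCat.{u} A) [IsLocalizable S]

instance : (iRes S).IsRightAdjoint := (iLambdaResAdj S).isRightAdjoint

instance : (iLambdaRes S).IsLeftAdjoint := (iLambdaResAdj S).isLeftAdjoint

instance : PreservesFiniteLimits (iRes S) where
  preservesFiniteLimits _ _ _ := inferInstance

instance : (iRes S).Additive where
  map_add := rfl

instance : PreservesFiniteColimits (iRes S) := by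
  have h1 : PreservesFiniteColimits ((ModuleCat.isFG.{u} (LAlg S)).ι) :=
    inferInstanceAs (PreservesFiniteColimits
      (forget₂ (FGModuleCat.{u} (LAlg S)) (ModuleCat.{u} (LAlg S))))
  have h2 : PreservesFiniteColimits (ModuleCat.restrictScalars.{u} (retraction S)) :=
    ⟨fun _ _ _ => inferInstance⟩
  have : PreservesFiniteColimits (iRes S ⋙ (ModuleCat.isFG.{u} A).ι) :=
    comp_preservesFiniteColimits (ModuleCat.isFG.{u} (LAlg S)).ι
      (ModuleCat.restrictScalars (retraction S))
  have : ReflectsFiniteColimits (ModuleCat.isFG.{u} A).ι := {}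
  exact preservesFiniteColimits_of_reflects_of_preserves (iRes S) (ModuleCat.isFG.{u} A).ι

instance : (iLambdaRes S).Additive := (iLambdaResAdj S).left_adjoint_additive

instance : PreservesFiniteColimits (iLambdaRes S) where
  preservesFiniteColimits _ _ _ := inferInstance

theorem locUnit_app_eq (X : FGModuleCat.{u} A) :
    (locUnit S).app X = (exists_universal S X).choose_spec.choose := by
  have h := Adjunction.homEquiv_id (iLambdaAdj S) X
  have h' : (iLambdaAdj S).homEquiv X _ (𝟙 ((iLambda S).obj X)) =
      reflEquiv S X _ (𝟙 (exists_universal S X).choose) := by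
    simp [iLambdaAdj, iLambda, Adjunction.adjunctionOfEquivLeft]
    rfl
  rw [← h, h']
  change (exists_universal S X).choose_spec.choose ≫ 𝟙 _ = _
  exact Category.comp_id _

/-- The functor `i_λ` preserves injections; being right exact, it is exact. -/
theorem injective_iLambdaRes {X Y : FGModuleCat.{u} A} (f : X ⟶ Y)
    (hf : Function.Injective f.hom.hom) : Function.Injective ((iLambdaRes S).map f).hom.hom := by
  have hspec := (exists_maximal S).choose_spec
  have hX := (exists_universal S X).choose_spec.choose_spec.2.2
  have hY := (exists_universal S Y).choose_spec.choose_spec.2.1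
  have hL := (hspec.2.2.2 _).1 ((iLambda S).obj X).property
  refine injective_of_reflection hspec.1 ((locUnit S).app X).hom.hom
    ((locUnit S).app Y).hom.hom f.hom.hom ((iLambda S).map f).hom.hom.hom hf ?_ hL ?_ ?_
  · intro x
    exact (LinearMap.congr_fun (congrArg (fun g => g.hom.hom) ((locUnit S).naturality f)) x).symm
  · rw [locUnit_app_eq]
    exact hY
  · rw [locUnit_app_eq]
    exact hX

instance : (iLambdaRes S).PreservesMonomorphisms where
  preserves {X Y} f hf := by
    have h1 : Mono ((forget₂ (FGModuleCat.{u} A) (ModuleCat.{u} A)).map f) := inferInstance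
    have h2 := injective_iLambdaRes S f ((ModuleCat.mono_iff_injective _).1 h1)
    have h3 : Mono ((forget₂ (FGModuleCat.{u} (LAlg S)) (ModuleCat.{u} (LAlg S))).map
      ((iLambdaRes S).map f)) := (ModuleCat.mono_iff_injective _).2 h2
    exact Functor.mono_of_mono_map _ h3

instance : PreservesFiniteLimits (iLambdaRes S) := by
  have := (iLambdaRes S).preservesHomology_of_preservesMonos_and_cokernels
  exact (iLambdaRes S).preservesFiniteLimits_of_preservesHomology

end Exactness

section
variable (C : Type u) [Category.{v} C] [Abelian C] [HasDerivedCategory.{w} C]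

/-- The objects of the derived category isomorphic to a bounded complex of projective objects. -/
def perfectComplexes : ObjectProperty (DerivedCategory C) := fun X =>
  ∃ (K : CochainComplex C ℤ) (a b : ℤ), K.IsStrictlyGE a ∧ K.IsStrictlyLE b ∧
    (∀ n, Projective (K.X n)) ∧ Nonempty (X ≅ DerivedCategory.Q.obj K)

instance : (perfectComplexes C).IsClosedUnderIsomorphisms where
  of_iso := by
    rintro X Y e ⟨K, a, b, ha, hb, hK, ⟨e'⟩⟩
    exact ⟨K, a, b, ha, hb, hK, ⟨e.symm ≪≫ e'⟩⟩

instance : (perfectComplexes C).ContainsZero where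
  exists_zero := by
    refine ⟨DerivedCategory.Q.obj (HomologicalComplex.zero), DerivedCategory.Q.map_isZero HomologicalComplex.isZero_zero,
      HomologicalComplex.zero, 0, 0, ?_, ?_, ?_, ⟨Iso.refl _⟩⟩
    · rw [CochainComplex.isStrictlyGE_iff]
      exact fun i _ => (HomologicalComplex.eval C (ComplexShape.up ℤ) i).map_isZero HomologicalComplex.isZero_zero
    · rw [CochainComplex.isStrictlyLE_iff]
      exact fun i _ => (HomologicalComplex.eval C (ComplexShape.up ℤ) i).map_isZero HomologicalComplex.isZero_zero
    · exact fun n => Projective.of_iso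
        ((isZero_zero C).iso ((HomologicalComplex.eval C (ComplexShape.up ℤ) n).map_isZero HomologicalComplex.isZero_zero)) inferInstance

instance : (perfectComplexes C).IsStableUnderShift ℤ where
  isStableUnderShiftBy n := ⟨by
    rintro X ⟨K, a, b, ha, hb, hK, ⟨e⟩⟩
    refine ⟨K⟦n⟧, a - n, b - n, K.isStrictlyGE_shift a n _ (by lia), K.isStrictlyLE_shift b n _ (by lia),
      fun i => ?_, ⟨(shiftFunctor (DerivedCategory C) n).mapIso e ≪≫
        (DerivedCategory.Q.commShiftIso n).symm.app K⟩⟩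
    exact hK (i + n)⟩

instance : (perfectComplexes C).IsTriangulatedClosed₃ := .mk' (by
  rintro T hT ⟨K, a, b, ha, hb, hK, ⟨e⟩⟩ ⟨L, a', b', ha', hb', hL, ⟨e'⟩⟩
  have := CochainComplex.isKProjective_of_projective K b
  obtain ⟨f, hf⟩ := (CochainComplex.IsKProjective.Qh_map_bijective K
    ((HomotopyCategory.quotient _ _).obj L)).surjective
    ((DerivedCategory.quotientCompQhIso C).hom.app K ≫ e.inv ≫ T.mor₁ ≫ e'.hom ≫
      (DerivedCategory.quotientCompQhIso C).inv.app L)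
  obtain ⟨f, rfl⟩ := (HomotopyCategory.quotient _ _).map_surjective f
  have hf' : T.mor₁ ≫ e'.hom = e.hom ≫ DerivedCategory.Q.map f := by
    have h1 := DerivedCategory.quotientCompQhIso_hom_naturality f
    rw [hf] at h1
    simp only [Category.assoc, Iso.inv_hom_id_app, Category.comp_id] at h1
    have h2 := (cancel_epi ((DerivedCategory.quotientCompQhIso C).hom.app K)).1 h1
    rw [← h2, Iso.hom_inv_id_assoc]
  refine ⟨CochainComplex.mappingCone f, min (a - 1) a', max b b', ?_, ?_, ?_, ⟨?_⟩⟩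
  · rw [CochainComplex.isStrictlyGE_iff]
    intro i hi
    rw [CochainComplex.mappingCone.isZero_X_iff f i]
    exact ⟨K.isZero_of_isStrictlyGE a _ (by lia), L.isZero_of_isStrictlyGE a' _ (by lia)⟩
  · rw [CochainComplex.isStrictlyLE_iff]
    intro i hi
    rw [CochainComplex.mappingCone.isZero_X_iff f i]
    exact ⟨K.isZero_of_isStrictlyLE b _ (by lia), L.isZero_of_isStrictlyLE b' _ (by lia)⟩
  · intro n
    exact Projective.of_iso (HomologicalComplex.homotopyCofiber.XIsoBiprod f n (n + 1) rfl).symm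
      inferInstance
  · exact Triangle.π₃.mapIso (isoTriangleOfIso₁₂ _ _ hT
      (DerivedCategory.mappingCone_triangle_distinguished f) e e' hf'))

instance : (perfectComplexes C).IsTriangulated where
  toIsTriangulatedClosed₂ := .of_isTriangulatedClosed₃

/-- The perfect complexes, as objects of the bounded derived category. -/
abbrev boundedPerf : ObjectProperty (DerivedCategory.Bounded C) :=
  (perfectComplexes C).inverseImage DerivedCategory.Bounded.ι

end
section
variable {C : Type u} [Category.{v} C] [Abelian C] [HasDerivedCategory.{w} C]
variable {D : Type u} [Category.{v} D] [Abelian D] [HasDerivedCategory.{w} D]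
 (F : C ⥤ D) [F.Additive] [PreservesFiniteLimits F] [PreservesFiniteColimits F]
open DerivedCategory in
/-- The natural extension to bounded derived categories of an exact functor `F`, applying `F`
degreewise to complexes. -/
def mapBounded : DerivedCategory.Bounded C ⥤ DerivedCategory.Bounded D :=
  ObjectProperty.lift _ (Bounded.ι ⋙ F.mapDerivedCategory) (by
    rintro ⟨X, ⟨⟨a, ha⟩, ⟨b, hb⟩⟩⟩
    have : X.IsGE a := ha
    have : X.IsLE b := hb
    obtain ⟨K, hK, hK', ⟨e⟩⟩ := X.exists_iso_Q_obj_of_isGE_of_isLE a b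
    let e' := F.mapDerivedCategory.mapIso e ≪≫ F.mapDerivedCategoryFactors.app K
    exact ⟨⟨a, ⟨⟨_, e', inferInstance⟩⟩⟩, ⟨b, ⟨⟨_, e', inferInstance⟩⟩⟩⟩)

instance : (mapBounded F).CommShift ℤ := by dsimp only [mapBounded]; infer_instance
instance : (mapBounded F).IsTriangulated := by dsimp only [mapBounded]; infer_instance
end

section SingularityCategory

instance (B : Type u) [Ring B] [IsNoetherianRing B] :
    HasDerivedCategory (FGModuleCat.{u} B) := HasDerivedCategory.standard _

/-- The bounded derived category `D^b(B-mod)` of finitely generated `B`-modules. -/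
abbrev Db (B : Type u) [Ring B] [IsNoetherianRing B] :=
  DerivedCategory.Bounded (FGModuleCat.{u} B)

/-- The full subcategory `perf(B)` of perfect complexes in `D^b(B-mod)`. -/
abbrev perf (B : Type u) [Ring B] [IsNoetherianRing B] : ObjectProperty (Db B) :=
  boundedPerf (FGModuleCat.{u} B)

/-- The singularity category `D_sg(B)`: the Verdier quotient of `D^b(B-mod)` by `perf(B)`, i.e.
the localization with respect to the morphisms whose cone lies in `perf(B)`. -/
abbrev Dsg (B : Type u) [Ring B] [IsNoetherianRing B] := (perf B).trW.Localization

/-- The quotient functor `D^b(B-mod) → D_sg(B)`. -/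
abbrev quot (B : Type u) [Ring B] [IsNoetherianRing B] : Db B ⥤ Dsg B := (perf B).trW.Q

variable {A : Type u} [Ring A] [IsArtinAlgebra A] (S : ModuleCat.{u} A) [IsLocalizable S]

/-- The functor `i_λ^* : D^b(A-mod) → D^b(L(A)-mod)`. -/
abbrev iLambdaStar : Db A ⥤ Db (LAlg S) := mapBounded (iLambdaRes S)

/-- The functor `i^* : D^b(L(A)-mod) → D^b(A-mod)`. -/
abbrev iStar : Db (LAlg S) ⥤ Db A := mapBounded (iRes S)

end SingularityCategory

end LeftRetraction

end

open LeftRetraction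

/-! Write `S` as `A ⧸ m` with `m` a maximal left ideal; since `S` has projective dimension at most
one, `m` is projective. By construction of the reflection, the kernel and the cokernel of `η_X : X →
L(X)` are generated by elements killed by `m`. Such a finitely generated module is a direct summand
of some `(A ⧸ m)^k`, so it has projective dimension at most one and is perfect
(`hasProjectiveDimensionLT_of_tors_eq_top`). Hence `η_X` becomes invertible in the singularity
category for every module `X`.

Three facts turn this into an equivalence. The counit of `i_λ ⊣ i` is invertible because `i` is
fully faithful (`isIso_counit`). The functor `i_λ` preserves projectives, being left adjoint to an
exact functor. Finally, factoring `η_A` through its image bounds the projective dimension of `L(A)`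
over `A` by two, so restrictions of projective `L(A)`-modules are perfect over `A`.

The passage from modules to complexes is formal. The unit extends degreewise to a shift-compatible
transformation of triangulated functors, and the objects at which such a transformation is
invertible form a triangulated subcategory. As `D^b` is generated by modules in degree zero,
checking on modules suffices (`exists_equivalence_of_perfect_unit`). Functors inverse to each other
up to objects of the subcategories descend to the Verdier quotients
(`exists_equivalence_localization`). -/

namespace CategoryTheory.NatTrans

/-! ### Detecting compatibility with shifts. -/

variable {C D E : Type*} [Category* C] [Category* D] [Category* E]
  {A : Type*} [AddMonoid A] [HasShift C A] [HasShift D A] [HasShift E A]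

/-- Compatibility with shifts can be checked after precomposition with a localization functor. -/
theorem CommShift.of_whiskerLeft (L : C ⥤ D) (W : MorphismProperty C) [L.IsLocalization W]
    [L.CommShift A] {F G : D ⥤ E} [F.CommShift A] [G.CommShift A] (τ : F ⟶ G)
    [h : NatTrans.CommShift (Functor.whiskerLeft L τ) A] : NatTrans.CommShift τ A := by
  refine ⟨fun a => Localization.natTrans_ext L W fun X => ?_⟩
  have h1 := NatTrans.shift_app_comm (Functor.whiskerLeft L τ) a X
  simp only [Functor.commShiftIso_comp_hom_app, Functor.whiskerLeft_app, Category.assoc] at h1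
  -- Naturality of `τ` moves the shift isomorphism of `L` to the front of both sides, where it
  -- cancels.
  rw [← NatTrans.naturality_assoc, cancel_epi] at h1
  exact h1

/-- Compatibility with shifts can be checked after composition with a faithful functor. -/
theorem CommShift.of_whiskerRight (H : D ⥤ E) [H.Faithful] [H.CommShift A]
    {F G : C ⥤ D} [F.CommShift A] [G.CommShift A] (τ : F ⟶ G)
    [h : NatTrans.CommShift (Functor.whiskerRight τ H) A] : NatTrans.CommShift τ A := by
  refine ⟨fun a => ?_⟩
  ext X
  apply H.map_injective
  have h1 := NatTrans.shift_app_comm (Functor.whiskerRight τ H) a X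
  simp only [Functor.commShiftIso_comp_hom_app, Functor.whiskerRight_app, Category.assoc,
    ← Functor.commShiftIso_hom_naturality] at h1
  rw [← Functor.map_comp_assoc, ← Functor.map_comp_assoc, cancel_mono] at h1
  exact h1

end CategoryTheory.NatTrans

/-! ### Descent of triangulated functors to Verdier quotients. -/

namespace CategoryTheory.Triangulated

variable {T₁ T₂ : Type*} [Category* T₁] [Category* T₂]
  [HasZeroObject T₁] [HasZeroObject T₂] [Preadditive T₁] [Preadditive T₂]
  [HasShift T₁ ℤ] [HasShift T₂ ℤ]
  [∀ n : ℤ, (shiftFunctor T₁ n).Additive] [∀ n : ℤ, (shiftFunctor T₂ n).Additive]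
  [Pretriangulated T₁] [Pretriangulated T₂] [IsTriangulated T₁] [IsTriangulated T₂]

/-- The objects at which a natural transformation is invertible. -/
def isIsoAppProperty {C D : Type*} [Category* C] [Category* D] {F G : C ⥤ D} (τ : F ⟶ G) :
    ObjectProperty C := fun X => IsIso (τ.app X)

instance {C D : Type*} [Category* C] [Category* D] {F G : C ⥤ D} (τ : F ⟶ G) :
    (isIsoAppProperty τ).IsClosedUnderIsomorphisms where
  of_iso {X Y} e hX := by
    have : IsIso (τ.app X) := hX
    have h : τ.app Y = F.map e.inv ≫ τ.app X ≫ G.map e.hom := by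
      rw [← τ.naturality, ← Functor.map_comp_assoc, e.inv_hom_id, F.map_id, Category.id_comp]
    change IsIso (τ.app Y)
    rw [h]
    infer_instance

/-- The objects at which a natural transformation between triangulated functors is invertible
form a triangulated subcategory. -/
instance isTriangulated_isIsoAppProperty {F G : T₁ ⥤ T₂} [F.CommShift ℤ] [G.CommShift ℤ]
    [F.IsTriangulated] [G.IsTriangulated] (τ : F ⟶ G) [NatTrans.CommShift τ ℤ] :
    (isIsoAppProperty τ).IsTriangulated where
  exists_zero := by
    obtain ⟨Z, hZ⟩ := HasZeroObject.zero (C := T₁)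
    exact ⟨Z, hZ, 0, (F.map_isZero hZ).eq_of_src _ _, (G.map_isZero hZ).eq_of_src _ _⟩
  isStableUnderShiftBy := fun n => ⟨fun X (hX : IsIso (τ.app X)) => by
    change IsIso (τ.app (X⟦n⟧))
    rw [NatTrans.app_shift]
    infer_instance⟩
  toIsTriangulatedClosed₂ := .mk' fun T hT (h₁ : IsIso _) (h₃ : IsIso _) => by
    -- The components of `τ` form a morphism of triangles; the square with the connecting maps is
    -- where compatibility with the shift enters. The triangulated five lemma then concludes.
    let φ : F.mapTriangle.obj T ⟶ G.mapTriangle.obj T :=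
      { hom₁ := τ.app _
        hom₂ := τ.app _
        hom₃ := τ.app _
        comm₁ := τ.naturality _
        comm₂ := τ.naturality _
        comm₃ := by
          change (F.map T.mor₃ ≫ (F.commShiftIso (1 : ℤ)).hom.app T.obj₁) ≫
            (τ.app T.obj₁)⟦(1 : ℤ)⟧' =
            τ.app T.obj₃ ≫ G.map T.mor₃ ≫ (G.commShiftIso (1 : ℤ)).hom.app T.obj₁
          rw [Category.assoc, NatTrans.shift_app_comm, NatTrans.naturality_assoc] }
    exact isIso₂_of_isIso₁₃ φ (F.map_distinguished T hT) (G.map_distinguished T hT) h₁ h₃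

open CategoryTheory.Localization in
/-- Triangulated functors which are mutually inverse up to objects of triangulated subcategories
induce mutually inverse triangle equivalences of the Verdier quotients. -/
theorem exists_equivalence_localization
    (P₁ : ObjectProperty T₁) (P₂ : ObjectProperty T₂)
    [P₁.IsTriangulated] [P₁.IsClosedUnderIsomorphisms]
    [P₂.IsTriangulated] [P₂.IsClosedUnderIsomorphisms]
    (F : T₁ ⥤ T₂) (G : T₂ ⥤ T₁) [F.CommShift ℤ] [G.CommShift ℤ]
    [F.IsTriangulated] [G.IsTriangulated]
    (hF : ∀ X, P₁ X → P₂ (F.obj X)) (hG : ∀ Y, P₂ Y → P₁ (G.obj Y))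
    (τ : 𝟭 T₁ ⟶ F ⋙ G) (σ : 𝟭 T₂ ⟶ G ⋙ F) [NatTrans.CommShift τ ℤ] [NatTrans.CommShift σ ℤ]
    (hτ : ∀ X, IsIso (P₁.trW.Q.map (τ.app X))) (hσ : ∀ Y, IsIso (P₂.trW.Q.map (σ.app Y))) :
    ∃ (e : P₁.trW.Localization ≌ P₂.trW.Localization) (_ : e.functor.CommShift ℤ)
      (_ : e.inverse.CommShift ℤ) (_ : e.CommShift ℤ), e.IsTriangulated ∧
      (∃ α : P₁.trW.Q ⋙ e.functor ≅ F ⋙ P₂.trW.Q, NatTrans.CommShift α.hom ℤ) ∧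
      (∃ β : P₂.trW.Q ⋙ e.inverse ≅ G ⋙ P₁.trW.Q, NatTrans.CommShift β.hom ℤ) := by
  -- By `hF`, `P₁` lies in the inverse image of `P₂`, so a cone in `P₁` is sent to a cone in `P₂`.
  have hF' : P₁.trW.IsInvertedBy (F ⋙ P₂.trW.Q) := fun X Y f hf =>
    P₂.inverseImage_trW_isInverted F P₂.trW.Q f (ObjectProperty.trW_monotone (fun X hX => hF X hX) _ hf)
  have hG' : P₂.trW.IsInvertedBy (G ⋙ P₁.trW.Q) := fun X Y f hf =>
    P₁.inverseImage_trW_isInverted G P₁.trW.Q f (ObjectProperty.trW_monotone (fun X hX => hG X hX) _ hf)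
  let Q₁ := P₁.trW.Q
  let Q₂ := P₂.trW.Q
  let Φ := lift (F ⋙ Q₂) hF' Q₁
  let Ψ := lift (G ⋙ Q₁) hG' Q₂
  let _ : Lifting Q₁ P₁.trW (F ⋙ Q₂) Φ := liftingLift _ hF' _
  let _ : Lifting Q₂ P₂.trW (G ⋙ Q₁) Ψ := liftingLift _ hG' _
  -- The shift structures are those determined by the localizations, which makes `α` and `β`
  -- compatible with shifts.
  let cΦ : Φ.CommShift ℤ := Functor.commShiftOfLocalization Q₁ P₁.trW ℤ (F ⋙ Q₂) Φ
  let cΨ : Ψ.CommShift ℤ := Functor.commShiftOfLocalization Q₂ P₂.trW ℤ (G ⋙ Q₁) Ψ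
  let α : Q₁ ⋙ Φ ≅ F ⋙ Q₂ := Lifting.iso Q₁ P₁.trW (F ⋙ Q₂) Φ
  let β : Q₂ ⋙ Ψ ≅ G ⋙ Q₁ := Lifting.iso Q₂ P₂.trW (G ⋙ Q₁) Ψ
  have hα : NatTrans.CommShift α.hom ℤ :=
    NatTrans.commShift_iso_hom_of_localization Q₁ P₁.trW ℤ (F ⋙ Q₂) Φ
  have hβ : NatTrans.CommShift β.hom ℤ :=
    NatTrans.commShift_iso_hom_of_localization Q₂ P₂.trW ℤ (G ⋙ Q₁) Ψ
  have : ∀ X, IsIso ((Functor.whiskerRight τ Q₁).app X) := hτ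
  have : ∀ X, IsIso ((Functor.whiskerRight σ Q₂).app X) := hσ
  let τ' : 𝟭 T₁ ⋙ Q₁ ≅ (F ⋙ G) ⋙ Q₁ :=
    have := NatIso.isIso_of_isIso_app (Functor.whiskerRight τ Q₁)
    asIso (Functor.whiskerRight τ Q₁)
  let σ' : 𝟭 T₂ ⋙ Q₂ ≅ (G ⋙ F) ⋙ Q₂ :=
    have := NatIso.isIso_of_isIso_app (Functor.whiskerRight σ Q₂)
    asIso (Functor.whiskerRight σ Q₂)
  have hσ' : NatTrans.CommShift σ'.hom ℤ :=
    inferInstanceAs (NatTrans.CommShift (Functor.whiskerRight σ Q₂) ℤ)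
  let a : (F ⋙ Q₂) ⋙ Ψ ≅ Q₁ := Functor.associator _ _ _ ≪≫ Functor.isoWhiskerLeft F β ≪≫
    (Functor.associator _ _ _).symm ≪≫ τ'.symm ≪≫ Functor.leftUnitor _
  let b : (G ⋙ Q₁) ⋙ Φ ≅ Q₂ := Functor.associator _ _ _ ≪≫ Functor.isoWhiskerLeft G α ≪≫
    (Functor.associator _ _ _).symm ≪≫ σ'.symm ≪≫ Functor.leftUnitor _
  -- Only `b` needs this, not `a`: compatibility of an equivalence with shifts can be tested on its
  -- counit alone, and the counit is built from `β` and `b`.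
  have hb : NatTrans.CommShift b.hom ℤ := by
    dsimp only [b, Iso.trans_hom, Functor.isoWhiskerLeft_hom, Iso.symm_hom]
    infer_instance
  let e := Localization.equivalence Q₁ P₁.trW Q₂ P₂.trW (F ⋙ Q₂) Φ (G ⋙ Q₁) Ψ a b
  let _ : e.functor.CommShift ℤ := cΦ
  let _ : e.inverse.CommShift ℤ := cΨ
  have he : e.CommShift ℤ := by
    apply Equivalence.CommShift.mk''
    -- On the image of `Q₂` the counit is this composite of shift-compatible transformations, and
    -- `Q₂` is a localization functor.
    have h1 : Functor.whiskerLeft Q₂ e.counitIso.hom =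
        (Functor.associator Q₂ Ψ Φ).inv ≫ Functor.whiskerRight β.hom Φ ≫ b.hom ≫
          (Functor.rightUnitor Q₂).inv := by
      ext X
      have := congrArg Iso.hom (equivalence_counitIso_app Q₁ P₁.trW Q₂ P₂.trW (F ⋙ Q₂) Φ (G ⋙ Q₁) Ψ a b X)
      change e.counitIso.hom.app (Q₂.obj X) = _
      simp only [e]
      refine this.trans ?_
      simp [β]
      rfl
    have h2 : NatTrans.CommShift (Functor.whiskerLeft Q₂ e.counitIso.hom) ℤ := by
      rw [h1]
      change NatTrans.CommShift ((Functor.associator Q₂ Ψ Φ).inv ≫ Functor.whiskerRight β.hom Φ ≫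
        b.hom ≫ (Functor.rightUnitor Q₂).inv) ℤ
      infer_instance
    exact NatTrans.CommShift.of_whiskerLeft Q₂ P₂.trW e.counitIso.hom
  have hΦ : Φ.IsTriangulated := by
    -- Every morphism of the quotient is isomorphic to the image of one in `T₁`, so its
    -- distinguished triangles come from `T₁`, where `α` reduces the claim to `F ⋙ Q₂`.
    have := Localization.essSurj_mapArrow Q₁ P₁.trW
    exact Functor.isTriangulated_of_precomp_iso α
  exact ⟨e, inferInstance, inferInstance, he, Equivalence.IsTriangulated.mk' e hΦ,
    ⟨α, hα⟩, ⟨β, hβ⟩⟩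

end CategoryTheory.Triangulated

/-! ### Extending the unit to derived categories. -/

noncomputable section

namespace LeftRetraction

variable {C : Type u} [Category.{v} C] [Abelian C] [HasDerivedCategory.{w} C]
variable {D : Type u} [Category.{v} D] [Abelian D] [HasDerivedCategory.{w} D]
variable {F : C ⥤ D} [F.Additive] [PreservesFiniteLimits F] [PreservesFiniteColimits F]
variable {G : D ⥤ C} [G.Additive] [PreservesFiniteLimits G] [PreservesFiniteColimits G]
variable (τ : 𝟭 C ⟶ F ⋙ G)

/-- The degreewise extension of `τ : 𝟭 ⟶ F ⋙ G` to cochain complexes. -/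
@[simps]
def unitComplex : 𝟭 (CochainComplex C ℤ) ⟶
    F.mapHomologicalComplex (ComplexShape.up ℤ) ⋙ G.mapHomologicalComplex (ComplexShape.up ℤ) where
  app K := { f := fun i => τ.app (K.X i), comm' := fun i j _ => (τ.naturality (K.d i j)).symm }
  naturality K L f := by ext i; exact τ.naturality (f.f i)

instance : NatTrans.CommShift (unitComplex τ) ℤ where
  shift_comm n := by
    ext K i
    simp [Functor.commShiftIso_comp_hom_app]
    -- The shift isomorphisms of the degreewise extensions are identities in each degree, so both
    -- sides are `τ` at `K.X (i + n)`.
    exact ((congrArg (τ.app (K.X (i + n)) ≫ ·) ((Category.comp_id _).trans (G.map_id _))).trans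
      (Category.comp_id _)).symm

/-- The composite of the extensions of `F` and `G` to derived categories is induced by the
composite of their extensions to complexes. -/
def mapDerivedCategoryCompFactors :
    DerivedCategory.Q ⋙ F.mapDerivedCategory ⋙ G.mapDerivedCategory ≅
      (F.mapHomologicalComplex (ComplexShape.up ℤ) ⋙
        G.mapHomologicalComplex (ComplexShape.up ℤ)) ⋙ DerivedCategory.Q :=
  (Functor.associator _ _ _).symm ≪≫
    Functor.isoWhiskerRight F.mapDerivedCategoryFactors G.mapDerivedCategory ≪≫
    Functor.associator _ _ _ ≪≫
    Functor.isoWhiskerLeft _ G.mapDerivedCategoryFactors ≪≫ (Functor.associator _ _ _).symm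

instance : NatTrans.CommShift (mapDerivedCategoryCompFactors (F := F) (G := G)).hom ℤ := by
  dsimp only [mapDerivedCategoryCompFactors, Iso.trans_hom, Functor.isoWhiskerLeft_hom,
    Functor.isoWhiskerRight_hom, Iso.symm_hom]
  infer_instance

instance : Localization.Lifting DerivedCategory.Q
    (HomologicalComplex.quasiIso C (ComplexShape.up ℤ))
    ((F.mapHomologicalComplex (ComplexShape.up ℤ) ⋙
        G.mapHomologicalComplex (ComplexShape.up ℤ)) ⋙ DerivedCategory.Q)
    (F.mapDerivedCategory ⋙ G.mapDerivedCategory) := ⟨mapDerivedCategoryCompFactors⟩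

/-- The extension of `τ : 𝟭 ⟶ F ⋙ G` to derived categories. -/
def unitDerived : 𝟭 (DerivedCategory C) ⟶ F.mapDerivedCategory ⋙ G.mapDerivedCategory :=
  Localization.liftNatTrans DerivedCategory.Q (HomologicalComplex.quasiIso C (ComplexShape.up ℤ))
    DerivedCategory.Q ((F.mapHomologicalComplex (ComplexShape.up ℤ) ⋙
        G.mapHomologicalComplex (ComplexShape.up ℤ)) ⋙ DerivedCategory.Q) _ _
    ((Functor.leftUnitor _).inv ≫ Functor.whiskerRight (unitComplex τ) DerivedCategory.Q)

/-- Makes the abstractly lifted transformation computable: on an actual complex it is the degreewise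
`τ`, up to the comparison isomorphism. -/
theorem unitDerived_app (K : CochainComplex C ℤ) :
    (unitDerived τ).app (DerivedCategory.Q.obj K) =
      DerivedCategory.Q.map ((unitComplex τ).app K) ≫ mapDerivedCategoryCompFactors.inv.app K := by
  rw [unitDerived, Localization.liftNatTrans_app]
  change 𝟙 _ ≫ (𝟙 _ ≫ DerivedCategory.Q.map ((unitComplex τ).app K)) ≫
    mapDerivedCategoryCompFactors.inv.app K = _
  simp

instance : NatTrans.CommShift (unitDerived τ) ℤ := by
  have h : Functor.whiskerLeft DerivedCategory.Q (unitDerived τ) =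
      (Functor.rightUnitor _).hom ≫ (Functor.leftUnitor _).inv ≫
        Functor.whiskerRight (unitComplex τ) DerivedCategory.Q ≫
          mapDerivedCategoryCompFactors.inv := by
    ext K
    change (unitDerived τ).app (DerivedCategory.Q.obj K) = 𝟙 _ ≫ 𝟙 _ ≫ _
    rw [unitDerived_app, Category.id_comp, Category.id_comp]
    rfl
  have : NatTrans.CommShift (Functor.whiskerLeft DerivedCategory.Q (unitDerived τ)) ℤ := by
    rw [h]; infer_instance
  exact NatTrans.CommShift.of_whiskerLeft DerivedCategory.Q
    (HomologicalComplex.quasiIso C (ComplexShape.up ℤ)) _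

/-- Every object is isomorphic to the image of a complex, where invertibility can be tested degree
by degree. -/
theorem isIso_unitDerived [IsIso τ] (X : DerivedCategory C) : IsIso ((unitDerived τ).app X) := by
  have h : ∀ K, IsIso ((unitDerived τ).app (DerivedCategory.Q.obj K)) := fun K => by
    have : IsIso ((unitComplex τ).app K) := by
      have : ∀ i, IsIso (((unitComplex τ).app K).f i) := fun i =>
        inferInstanceAs (IsIso (τ.app (K.X i)))
      exact HomologicalComplex.Hom.isIso_of_components _
    rw [unitDerived_app]
    infer_instance
  have e := DerivedCategory.Q.objObjPreimageIso X
  exact (Triangulated.isIsoAppProperty (unitDerived τ)).prop_of_iso e (h _)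

/-- The extension of `τ : 𝟭 ⟶ F ⋙ G` to bounded derived categories. -/
def unitBounded : 𝟭 (DerivedCategory.Bounded C) ⟶ mapBounded F ⋙ mapBounded G where
  app X := ObjectProperty.homMk ((unitDerived τ).app X.obj)
  naturality _ _ f := ObjectProperty.hom_ext _ ((unitDerived τ).naturality f.hom)

theorem isIso_unitBounded [IsIso τ] (X : DerivedCategory.Bounded C) :
    IsIso ((unitBounded τ).app X) := by
  rw [← ObjectProperty.isIso_hom_iff]
  exact isIso_unitDerived τ X.obj

/-- The extension of `F` to bounded derived categories is a restriction of that to derived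
categories. -/
def mapBoundedCompι : mapBounded F ⋙ DerivedCategory.Bounded.ι ≅
    DerivedCategory.Bounded.ι ⋙ F.mapDerivedCategory :=
  ObjectProperty.liftCompιIso _ _ _

instance : NatTrans.CommShift (mapBoundedCompι (F := F)).hom ℤ :=
  Functor.CommShift.ofComp_compatibility
    (ObjectProperty.liftCompιIso _ (DerivedCategory.Bounded.ι ⋙ F.mapDerivedCategory) _) ℤ

instance : NatTrans.CommShift (unitBounded τ) ℤ := by
  have h : Functor.whiskerRight (unitBounded τ) DerivedCategory.Bounded.ι =
      (Functor.leftUnitor _).hom ≫ (Functor.rightUnitor _).inv ≫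
        Functor.whiskerLeft DerivedCategory.Bounded.ι (unitDerived τ) ≫
        (Functor.associator _ _ _).inv ≫ Functor.whiskerRight mapBoundedCompι.inv _ ≫
        (Functor.associator _ _ _).hom ≫ Functor.whiskerLeft _ mapBoundedCompι.inv ≫
        (Functor.associator _ _ _).inv := by
    ext X
    -- All comparison isomorphisms with the unbounded derived category have identity components.
    change (unitDerived τ).app X.obj = 𝟙 _ ≫ 𝟙 _ ≫ (unitDerived τ).app X.obj ≫ 𝟙 _ ≫
      G.mapDerivedCategory.map (𝟙 _) ≫ 𝟙 _ ≫ 𝟙 _ ≫ 𝟙 _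
    simp
  have : NatTrans.CommShift
      (Functor.whiskerRight (unitBounded τ) DerivedCategory.Bounded.ι) ℤ := by
    rw [h]; infer_instance
  exact NatTrans.CommShift.of_whiskerRight DerivedCategory.Bounded.ι _

end LeftRetraction

end

/-! ### Dévissage from bounded complexes to single objects. -/

noncomputable section

namespace LeftRetraction

section

variable {C : Type u} [Category.{v} C] [Abelian C]

/-- Replacing the target of `f` by the subobject `image f` does not affect exactness in the middle.
-/
theorem shortExact_kernel_image {X Y : C} (f : X ⟶ Y) :
    (ShortComplex.mk (kernel.ι f) (factorThruImage f)
      (by rw [← cancel_mono (image.ι f)]; simp)).ShortExact where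
  exact := by
    let φ : ShortComplex.mk (kernel.ι f) (factorThruImage f)
        (by rw [← cancel_mono (image.ι f)]; simp) ⟶
        ShortComplex.mk (kernel.ι f) f (kernel.condition f) :=
      { τ₁ := 𝟙 _, τ₂ := 𝟙 _, τ₃ := image.ι f }
    exact (ShortComplex.exact_iff_of_epi_of_isIso_of_mono φ).2 (ShortComplex.exact_kernel f)

/-- Dually, precomposing with the epimorphism `factorThruImage f` does not affect exactness in the
middle. -/
theorem shortExact_image_cokernel {X Y : C} (f : X ⟶ Y) :
    (ShortComplex.mk (image.ι f) (cokernel.π f)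
      (by rw [← cancel_epi (factorThruImage f)]; simp)).ShortExact where
  exact := by
    let φ : ShortComplex.mk f (cokernel.π f) (cokernel.condition f) ⟶
        ShortComplex.mk (image.ι f) (cokernel.π f)
          (by rw [← cancel_epi (factorThruImage f)]; simp) :=
      { τ₁ := factorThruImage f, τ₂ := 𝟙 _, τ₃ := 𝟙 _ }
    exact (ShortComplex.exact_iff_of_epi_of_isIso_of_mono φ).1 (ShortComplex.exact_cokernel f)

end

section

variable {C : Type u} [Category.{v} C] [Abelian C] [HasDerivedCategory.{w} C]

open DerivedCategory

section Devissage

variable (P : ObjectProperty (DerivedCategory C)) [P.IsTriangulated]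
  [P.IsClosedUnderIsomorphisms]

/-- Shifting by `n` moves an object from degree `n` to degree zero, and `P` is stable under shifts.
-/
theorem prop_singleFunctor_of_zero {X : C} (h : P ((singleFunctor C 0).obj X)) (n : ℤ) :
    P (Q.obj ((HomologicalComplex.single C (ComplexShape.up ℤ) n).obj X)) := by
  have e : ((singleFunctor C 0).obj X) ≅ ((singleFunctor C n).obj X)⟦n⟧ :=
    (((DerivedCategory.singleFunctors C).shiftIso n 0 n (by lia)).app X).symm
  refine P.prop_of_iso ((singleFunctorIsoCompQ C n).app X) ?_
  rw [← P.prop_shift_iff_of_isStableUnderShift _ n]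
  exact P.prop_of_iso e h

/-- A triangulated subcategory containing the terms of a bounded complex contains the complex. -/
theorem prop_Q_obj_of_prop_single (n : ℕ) : ∀ (K : CochainComplex C ℤ) (a b : ℤ) (_ : b < a + n)
    [K.IsStrictlyGE a] [K.IsStrictlyLE b] (_ : ∀ i, P ((singleFunctor C 0).obj (K.X i))),
    P (Q.obj K) := by
  -- The bound `b < a + n` says that at most `n` degrees carry a nonzero term; for `n = 0` the
  -- complex vanishes.
  induction n with
  | zero =>
    intro K a b hab _ _ _
    refine P.prop_of_isZero (Q.map_isZero ?_)
    rw [IsZero.iff_id_eq_zero]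
    ext i
    refine IsZero.eq_of_src ?_ _ _
    by_cases hi : i < a
    · exact K.isZero_of_isStrictlyGE a i hi
    · exact K.isZero_of_isStrictlyLE b i (by lia)
  | succ n hn =>
    intro K a b hab _ _ hK
    -- The top term is a subcomplex since the differential leaving it is zero. The quotient has the
    -- same terms in the other degrees and vanishes in degree `b`, so induction applies to it.
    let f : (HomologicalComplex.single C (ComplexShape.up ℤ) b).obj (K.X b) ⟶ K :=
      HomologicalComplex.mkHomFromSingle (𝟙 (K.X b)) fun j hj => by
        have hj : b + 1 = j := hj
        exact (K.isZero_of_isStrictlyLE b j (by lia)).eq_of_tgt _ _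
    have hfb : IsIso (f.f b) := by
      rw [HomologicalComplex.mkHomFromSingle_f]
      infer_instance
    have hf0 : ∀ i, i ≠ b → IsZero (((HomologicalComplex.single C (ComplexShape.up ℤ) b).obj
      (K.X b)).X i) := fun i hi => HomologicalComplex.isZero_single_obj_X _ _ _ _ hi
    have hfi : ∀ i, Mono (f.f i) := fun i => by
      by_cases hi : i = b
      · subst hi; infer_instance
      · exact ⟨fun _ _ _ => (hf0 i hi).eq_of_tgt _ _⟩
    have hf : Mono f := HomologicalComplex.mono_of_mono_f f hfi
    let S := ShortComplex.mk f (cokernel.π f) (cokernel.condition f)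
    have hS : S.ShortExact := { exact := ShortComplex.exact_cokernel f }
    have hSi : ∀ i, (S.map (HomologicalComplex.eval C _ i)).ShortExact :=
      fun i => hS.map_of_exact _
    have hXb : IsZero ((cokernel f).X b) := by
      have : IsIso (S.map (HomologicalComplex.eval C _ b)).f := hfb
      have := (hSi b).epi_g
      exact (hSi b).isIso_f_iff.1 inferInstance
    have hXi : ∀ i, i ≠ b → IsIso ((cokernel.π f).f i) := fun i hi =>
      (hSi i).isIso_g_iff.2 (hf0 i hi)
    have hge : CochainComplex.IsStrictlyGE (cokernel f) a := by
      rw [CochainComplex.isStrictlyGE_iff]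
      intro i hi
      have := (hSi i).epi_g
      exact IsZero.of_epi ((cokernel.π f).f i) (K.isZero_of_isStrictlyGE a i hi)
    have hle : CochainComplex.IsStrictlyLE (cokernel f) (b - 1) := by
      rw [CochainComplex.isStrictlyLE_iff]
      intro i hi
      by_cases hib : i = b
      · subst hib; exact hXb
      · have := (hSi i).epi_g
        exact IsZero.of_epi ((cokernel.π f).f i) (K.isZero_of_isStrictlyLE b i (by lia))
    refine P.ext_of_isTriangulatedClosed₂ _ (triangleOfSES_distinguished hS) ?_ ?_
    · exact prop_singleFunctor_of_zero P (hK b) b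
    · refine hn (cokernel f) a (b - 1) (by lia) fun i => ?_
      by_cases hib : i = b
      · subst hib
        exact P.prop_of_isZero ((singleFunctor C 0).map_isZero hXb)
      · have := hXi i hib
        exact P.prop_of_iso ((singleFunctor C 0).mapIso (asIso ((cokernel.π f).f i))) (hK i)

theorem prop_Q_obj (K : CochainComplex C ℤ) (a b : ℤ)
    [K.IsStrictlyGE a] [K.IsStrictlyLE b] (hK : ∀ i, P ((singleFunctor C 0).obj (K.X i))) :
    P (Q.obj K) :=
  prop_Q_obj_of_prop_single P (b + 1 - a).toNat K a b (by lia) hK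

end Devissage

/-- The object of the bounded derived category given by an object of `C` in degree zero. -/
def singleBounded : C ⥤ DerivedCategory.Bounded C :=
  ObjectProperty.lift _ (singleFunctor C 0) fun X =>
    ⟨⟨0, (inferInstance : ((singleFunctor C 0).obj X).IsGE 0)⟩,
      ⟨0, (inferInstance : ((singleFunctor C 0).obj X).IsLE 0)⟩⟩

/-- The bounded derived category is generated by the objects of `C`. -/
theorem prop_of_prop_singleBounded (P : ObjectProperty (DerivedCategory.Bounded C))
    [P.IsTriangulated] [P.IsClosedUnderIsomorphisms] (h : ∀ M : C, P (singleBounded.obj M))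
    (X : DerivedCategory.Bounded C) : P X := by
  obtain ⟨X, hX⟩ := X
  obtain ⟨⟨a, ha⟩, ⟨b, hb⟩⟩ := id hX
  have : X.IsGE a := ha
  have : X.IsLE b := hb
  obtain ⟨K, hK, hK', ⟨e⟩⟩ := X.exists_iso_Q_obj_of_isGE_of_isLE a b
  -- The dévissage runs in the unbounded category, with the essential image of `P` there; fullness
  -- of the inclusion brings the resulting isomorphism back.
  have h1 : P.map DerivedCategory.Bounded.ι (Q.obj K) :=
    prop_Q_obj _ K a b fun i => P.prop_map_obj DerivedCategory.Bounded.ι (h (K.X i))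
  obtain ⟨Y, hY, ⟨e'⟩⟩ := h1
  exact P.prop_of_iso (ObjectProperty.isoMk _ (e' ≪≫ e.symm)) hY

/-- A morphism of `C` with perfect kernel and cokernel has a perfect cone. -/
theorem trW_singleFunctor_map (P : ObjectProperty (DerivedCategory C)) [P.IsTriangulated]
    [P.IsClosedUnderIsomorphisms] {X Y : C} (f : X ⟶ Y)
    (h₁ : P ((singleFunctor C 0).obj (kernel f))) (h₂ : P ((singleFunctor C 0).obj (cokernel f))) :
    P.trW ((singleFunctor C 0).map f) := by
  rw [← image.fac f, Functor.map_comp]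
  refine P.trW.comp_mem _ _ ?_ ?_
  -- For `X ⟶ image f` the object in `P` is the first vertex of the triangle (the kernel); for
  -- `image f ⟶ Y` it is the third (the cokernel).
  · exact ObjectProperty.trW.mk' _ (shortExact_kernel_image f).singleTriangle_distinguished h₁
  · exact ObjectProperty.trW.mk _ (shortExact_image_cokernel f).singleTriangle_distinguished h₂

end

end LeftRetraction

end

/-! ### Reduction of the equivalence to statements about single objects. -/

noncomputable section

namespace LeftRetraction

/-- Identifies the degreewise unit on a complex concentrated in degree zero with `τ` at its only
term, up to the isomorphisms commuting `F` and `G` with `single`. -/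
theorem unitComplex_app_single {C D : Type u} [Category.{v} C] [Abelian C] [Category.{v} D]
    [Abelian D] {F : C ⥤ D} [F.Additive] {G : D ⥤ C} [G.Additive]
    (τ : 𝟭 C ⟶ F ⋙ G) (M : C) :
    (unitComplex τ).app ((HomologicalComplex.single C (ComplexShape.up ℤ) 0).obj M) ≫
      (G.mapHomologicalComplex (ComplexShape.up ℤ)).map
        ((HomologicalComplex.singleMapHomologicalComplex F (ComplexShape.up ℤ) 0).hom.app M) ≫
      (HomologicalComplex.singleMapHomologicalComplex G (ComplexShape.up ℤ) 0).hom.app (F.obj M) =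
    (HomologicalComplex.single C (ComplexShape.up ℤ) 0).map (τ.app M) := by
  -- Naturality of `τ` along `s`, followed by cancellation of `G` applied to `t`, for arbitrary
  -- isomorphisms in place of the degree-zero identifications.
  have key {X M : C} {Y : D} {Z : C} (s : X ≅ M) (t : Y ≅ F.obj M) (r : Z ≅ G.obj (F.obj M)) :
      τ.app X ≫ G.map (F.map s.hom ≫ t.inv) ≫ G.map t.hom ≫ r.inv =
        s.hom ≫ τ.app M ≫ r.inv := by
    have h := τ.naturality s.hom
    simp only [Functor.id_map, Functor.comp_map] at h
    rw [reassoc_of% h, ← G.map_comp_assoc, Category.assoc, Iso.inv_hom_id, Category.comp_id]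
  apply HomologicalComplex.from_single_hom_ext
  simp only [HomologicalComplex.comp_f, unitComplex_app_f, Functor.mapHomologicalComplex_map_f,
    HomologicalComplex.singleMapHomologicalComplex_hom_app_self,
    HomologicalComplex.single_map_f_self]
  exact key _ _ _

section

variable {C : Type u} [Category.{v} C] [Abelian C] [HasDerivedCategory.{w} C]
variable {D : Type u} [Category.{v} D] [Abelian D] [HasDerivedCategory.{w} D]

open DerivedCategory

variable {F : C ⥤ D} [F.Additive] [PreservesFiniteLimits F] [PreservesFiniteColimits F]
variable {G : D ⥤ C} [G.Additive] [PreservesFiniteLimits G] [PreservesFiniteColimits G]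

/-- The class `P.trW` is invariant under isomorphism of arrows, so a condition on the cone of `τ.app
M` carries over to the derived unit at `M`. -/
theorem trW_unitDerived_app_single (τ : 𝟭 C ⟶ F ⋙ G) (P : ObjectProperty (DerivedCategory C))
    [P.IsTriangulated] [P.IsClosedUnderIsomorphisms] (M : C)
    (h : P.trW ((singleFunctor C 0).map (τ.app M))) :
    P.trW ((unitDerived τ).app ((singleFunctor C 0).obj M)) := by
  have h1 : P.trW (Q.map ((HomologicalComplex.single C (ComplexShape.up ℤ) 0).map (τ.app M))) :=
    (P.trW.arrow_mk_iso_iff (Arrow.isoMk ((singleFunctorIsoCompQ C 0).app _)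
      ((singleFunctorIsoCompQ C 0).app _) ((singleFunctorIsoCompQ C 0).hom.naturality _).symm)).1 h
  rw [← unitComplex_app_single, Functor.map_comp, P.trW.cancel_right_of_respectsIso] at h1
  have h2 : P.trW ((unitDerived τ).app
      (Q.obj ((HomologicalComplex.single C (ComplexShape.up ℤ) 0).obj M))) := by
    rw [unitDerived_app]
    exact (P.trW.cancel_right_of_respectsIso _ _).2 h1
  exact (P.trW.arrow_mk_iso_iff (Arrow.isoMk ((singleFunctorIsoCompQ C 0).app M)
    ((F.mapDerivedCategory ⋙ G.mapDerivedCategory).mapIso ((singleFunctorIsoCompQ C 0).app M))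
      ((unitDerived τ).naturality _))).2 h2

theorem perfectComplexes_single_of_projective (M : C) [Projective M] :
    perfectComplexes C ((singleFunctor C 0).obj M) :=
  ⟨(HomologicalComplex.single C (ComplexShape.up ℤ) 0).obj M, 0, 0, inferInstance, inferInstance,
    fun n => by
      by_cases hn : n = 0
      · subst hn
        exact Projective.of_iso (HomologicalComplex.singleObjXSelf (ComplexShape.up ℤ) 0 M).symm
          inferInstance
      · exact Projective.of_iso ((isZero_zero C).iso
          (HomologicalComplex.isZero_single_obj_X _ _ _ _ hn)) inferInstance,
    ⟨(singleFunctorIsoCompQ C 0).app M⟩⟩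

variable (F) in
-- By dévissage it is enough that each term `F.obj (K.X i)` be perfect. It need not be projective,
-- which matters for restriction of scalars.
theorem boundedPerf_mapBounded
    (hF : ∀ (M : C) [Projective M], perfectComplexes D ((singleFunctor D 0).obj (F.obj M)))
    (X : DerivedCategory.Bounded C) (hX : boundedPerf C X) :
    boundedPerf D ((mapBounded F).obj X) := by
  obtain ⟨K, a, b, _, _, hK, ⟨e⟩⟩ := hX
  exact (perfectComplexes D).prop_of_iso
    (F.mapDerivedCategory.mapIso e ≪≫ F.mapDerivedCategoryFactors.app K).symm
    (prop_Q_obj _ _ a b fun i => have := hK i; hF (K.X i))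

/-- Exact functors which preserve perfect complexes and are mutually inverse up to perfect
complexes induce mutually inverse triangle equivalences of singularity categories. -/
theorem exists_equivalence_of_perfect_unit (τ : 𝟭 C ⟶ F ⋙ G) (σ : 𝟭 D ⟶ G ⋙ F) [IsIso σ]
    (hF : ∀ (M : C) [Projective M], perfectComplexes D ((singleFunctor D 0).obj (F.obj M)))
    (hG : ∀ (M : D) [Projective M], perfectComplexes C ((singleFunctor C 0).obj (G.obj M)))
    (hker : ∀ M, perfectComplexes C ((singleFunctor C 0).obj (kernel (τ.app M))))
    (hcok : ∀ M, perfectComplexes C ((singleFunctor C 0).obj (cokernel (τ.app M)))) :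
    ∃ (e : (boundedPerf C).trW.Localization ≌ (boundedPerf D).trW.Localization)
      (_ : e.functor.CommShift ℤ) (_ : e.inverse.CommShift ℤ) (_ : e.CommShift ℤ),
      e.IsTriangulated ∧
      (∃ α : (boundedPerf C).trW.Q ⋙ e.functor ≅ mapBounded F ⋙ (boundedPerf D).trW.Q,
        NatTrans.CommShift α.hom ℤ) ∧
      (∃ β : (boundedPerf D).trW.Q ⋙ e.inverse ≅ mapBounded G ⋙ (boundedPerf C).trW.Q,
        NatTrans.CommShift β.hom ℤ) := by
  refine Triangulated.exists_equivalence_localization (boundedPerf C) (boundedPerf D)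
    (mapBounded F) (mapBounded G) (boundedPerf_mapBounded F hF) (boundedPerf_mapBounded G hG)
    (unitBounded τ) (unitBounded σ) (fun X => ?_) (fun Y => ?_)
  -- The objects whose unit becomes invertible in the quotient form a triangulated subcategory, so
  -- objects in degree zero suffice.
  · have := Triangulated.isTriangulated_isIsoAppProperty
      (Functor.whiskerRight (unitBounded τ) (boundedPerf C).trW.Q)
    refine prop_of_prop_singleBounded (Triangulated.isIsoAppProperty
      (Functor.whiskerRight (unitBounded τ) (boundedPerf C).trW.Q)) (fun M => ?_) X
    refine Localization.inverts (boundedPerf C).trW.Q (boundedPerf C).trW _ ?_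
    -- Perfectness of the cone may be tested in the unbounded derived category.
    rw [ObjectProperty.inverseImage_trW_iff]
    exact trW_unitDerived_app_single τ _ M (trW_singleFunctor_map _ _ (hker M) (hcok M))
  · have := isIso_unitBounded σ Y
    infer_instance

end

end LeftRetraction

end

/-! ### Projective dimension of modules generated by elements killed by `m`. -/

noncomputable section

namespace LeftRetraction

section

variable {C : Type u} [Category.{v} C] [Abelian C]

/-- The projective dimension of a direct summand of a finite sum of copies of `N` is bounded by
that of `N`. -/
theorem hasProjectiveDimensionLT_of_sum_eq_id {X N : C} {n k : ℕ} (s : Fin k → (X ⟶ N))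
    (r : Fin k → (N ⟶ X)) (h : ∑ j, s j ≫ r j = 𝟙 X) [HasProjectiveDimensionLT N n] :
    HasProjectiveDimensionLT X n := by
  let _ : HasExt.{max u v} C := HasExt.standard C
  rw [hasProjectiveDimensionLT_iff]
  intro i hi Y e
  -- Decomposing the identity writes `e` as a sum of classes each factoring through an `Ext` group
  -- of `N`, which vanishes in degrees at least `n`.
  rw [← Abelian.Ext.mk₀_id_comp e, ← h, Abelian.Ext.mk₀_sum, Abelian.Ext.sum_comp]
  refine Finset.sum_eq_zero fun j _ => ?_
  rw [← Abelian.Ext.mk₀_comp_mk₀_assoc,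
    Abelian.Ext.eq_zero_of_hasProjectiveDimensionLT ((Abelian.Ext.mk₀ (r j)).comp e (zero_add i))
      n hi, Abelian.Ext.comp_zero]

end

section

variable {A : Type u} [Ring A]

theorem hasProjectiveDimensionLT_of_retract_pi {X N : Type u} [AddCommGroup X] [Module A X]
    [AddCommGroup N] [Module A N] {n k : ℕ} (q : (Fin k → N) →ₗ[A] X) (σ : X →ₗ[A] (Fin k → N))
    (h : q ∘ₗ σ = LinearMap.id) [HasProjectiveDimensionLT (ModuleCat.of A N) n] :
    HasProjectiveDimensionLT (ModuleCat.of A X) n := by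
  refine hasProjectiveDimensionLT_of_sum_eq_id (N := ModuleCat.of A N)
    (fun j => ModuleCat.ofHom (LinearMap.proj j ∘ₗ σ))
    (fun j => ModuleCat.ofHom (q ∘ₗ LinearMap.single A (fun _ => N) j)) ?_
  ext x
  have h1 : ∑ j, q (Pi.single j (σ x j)) = x := by
    rw [← map_sum, Finset.univ_sum_single]
    exact LinearMap.congr_fun h x
  simpa [ModuleCat.hom_sum, LinearMap.sum_apply] using h1

variable {m : Submodule A A}

/-- In `0 → m → A → A ⧸ m → 0` the first two terms are projective. The index is strict: `LT 2` means
dimension at most one. -/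
theorem hasProjectiveDimensionLT_quotient [Module.Projective A m] :
    HasProjectiveDimensionLT (ModuleCat.of A (A ⧸ m)) 2 := by
  have : Projective (ModuleCat.of A m) := (IsProjective.iff_projective (R := A) m).1 inferInstance
  exact (simpleSeq_shortExact (S := ModuleCat.of A (A ⧸ m))
    (LinearEquiv.refl A (A ⧸ m))).hasProjectiveDimensionLT_X₃ 1
    (inferInstanceAs (HasProjectiveDimensionLT (ModuleCat.of A m) 1))
    (inferInstanceAs (HasProjectiveDimensionLT (ModuleCat.of A A) 2))

/-- Finitely generated modules generated by elements annihilated by `m` have projective dimension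
at most one. -/
theorem hasProjectiveDimensionLT_of_tors_eq_top (hm : IsCoatom m) [Module.Projective A m]
    {M : Type u} [AddCommGroup M] [Module A M] [Module.Finite A M] (h : tors m M = ⊤) :
    HasProjectiveDimensionLT (ModuleCat.of A M) 2 := by
  have hs : IsSimpleModule A (A ⧸ m) := isSimpleModule_iff_isCoatom.2 hm
  obtain ⟨s, hs, hsT⟩ := (Submodule.fg_span_iff_fg_span_finset_subset _).1
    (h ▸ Module.Finite.fg_top : (tors m M).FG)
  have hk : ∀ x : s, m ≤ LinearMap.ker (LinearMap.toSpanSingleton A M (x : M)) :=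
    fun x p hp => hs x.2 p hp
  let ε := s.equivFin
  -- Each chosen generator is killed by `m` and so defines a map from `A ⧸ m`. The sum of these maps
  -- is surjective, and it splits because its source is semisimple.
  let Φ : (Fin s.card → A ⧸ m) →ₗ[A] M :=
    ∑ j, (m.liftQ (LinearMap.toSpanSingleton A M (ε.symm j : M)) (hk _)) ∘ₗ LinearMap.proj j
  have hΦ : Function.Surjective Φ := by
    rw [← LinearMap.range_eq_top, eq_top_iff, ← h]
    change Submodule.span A _ ≤ _
    rw [hsT, Submodule.span_le]
    intro x hx
    refine ⟨Pi.single (ε ⟨x, hx⟩) (m.mkQ 1), ?_⟩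
    simp only [Φ, LinearMap.sum_apply, LinearMap.comp_apply, LinearMap.proj_apply]
    rw [Finset.sum_eq_single (ε ⟨x, hx⟩)]
    · simp
    · intro j _ hj
      rw [Pi.single_eq_of_ne hj, map_zero]
    · simp
  obtain ⟨σ, hσ⟩ := IsSemisimpleModule.lifting_property Φ hΦ LinearMap.id
  have := hasProjectiveDimensionLT_quotient (m := m)
  exact hasProjectiveDimensionLT_of_retract_pi Φ σ hσ

/-! ### Finitely generated modules of finite projective dimension. -/

variable [IsNoetherianRing A]

/-- Injective maps reflect membership in `tors` (`mem_tors_of_injective`); this is applied to the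
inclusion of the kernel. -/
theorem tors_kernel_eq_top (hm : IsCoatom m) {X Y : FGModuleCat.{u} A} (f : X ⟶ Y)
    (h : LinearMap.ker f.hom.hom ≤ tors m X) : tors m (kernel f : FGModuleCat.{u} A) = ⊤ := by
  have hι : Mono ((forget₂ (FGModuleCat.{u} A) (ModuleCat.{u} A)).map (kernel.ι f)) :=
    inferInstance
  rw [eq_top_iff]
  rintro x -
  refine mem_tors_of_injective hm (kernel.ι f).hom.hom ((ModuleCat.mono_iff_injective _).1 hι) (h ?_)
  exact LinearMap.congr_fun (congrArg (fun g => g.hom.hom) (kernel.condition f)) x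

theorem tors_cokernel_eq_top {X Y : FGModuleCat.{u} A} (f : X ⟶ Y)
    (h : tors m (Y ⧸ LinearMap.range f.hom.hom) = ⊤) :
    tors m (cokernel f : FGModuleCat.{u} A) = ⊤ := by
  have hπ : Epi ((forget₂ (FGModuleCat.{u} A) (ModuleCat.{u} A)).map (cokernel.π f)) :=
    inferInstance
  rw [eq_top_iff]
  rintro x -
  obtain ⟨y, rfl⟩ := (ModuleCat.epi_iff_surjective _).1 hπ x
  have hle : LinearMap.range f.hom.hom ≤ LinearMap.ker (cokernel.π f).hom.hom := by
    rintro _ ⟨x, rfl⟩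
    exact LinearMap.congr_fun (congrArg (fun g => g.hom.hom) (cokernel.condition f)) x
  -- The categorical cokernel receives a map from the quotient by the range, and linear maps
  -- preserve `tors`.
  exact map_tors ((LinearMap.range f.hom.hom).liftQ _ hle) (x := Submodule.Quotient.mk y)
    (h ▸ Submodule.mem_top)

theorem epi_of_surjective {X Y : FGModuleCat.{u} A} (f : X ⟶ Y)
    (hf : Function.Surjective f.hom.hom) : Epi f :=
  (forget₂ (FGModuleCat.{u} A) (ModuleCat.{u} A)).epi_of_epi_map
    ((ModuleCat.epi_iff_surjective _).2 hf)

instance (k : ℕ) : Projective (FGModuleCat.of A (Fin k → A)) where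
  factors {E X} f e he := by
    have he' : Epi ((forget₂ (FGModuleCat.{u} A) (ModuleCat.{u} A)).map e) := inferInstance
    obtain ⟨g, hg⟩ := Module.projective_lifting_property e.hom.hom f.hom.hom
      ((ModuleCat.epi_iff_surjective _).1 he')
    exact ⟨FGModuleCat.ofHom g, FGModuleCat.hom_ext hg⟩

theorem exists_epi_free (M : FGModuleCat.{u} A) :
    ∃ (k : ℕ) (p : FGModuleCat.of A (Fin k → A) ⟶ M), Epi p := by
  have : Module.Finite A M := M.property
  obtain ⟨k, p, hp⟩ := Module.Finite.exists_fin' A M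
  exact ⟨k, FGModuleCat.ofHom p, epi_of_surjective _ hp⟩

/-- Factor `f` through its image. Passing from the kernel to the image raises the bound by one; the
extension by the cokernel raises it no further. -/
theorem hasProjectiveDimensionLT_of_kernel_cokernel {X Y : FGModuleCat.{u} A} (f : X ⟶ Y) (n : ℕ)
    (hk : HasProjectiveDimensionLT (kernel f).obj n) (hX : HasProjectiveDimensionLT X.obj (n + 1))
    (hc : HasProjectiveDimensionLT (cokernel f).obj n) :
    HasProjectiveDimensionLT Y.obj (n + 1) := by
  have hS₁ := (shortExact_kernel_image f).map_of_exact
    (forget₂ (FGModuleCat.{u} A) (ModuleCat.{u} A))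
  have hS₂ := (shortExact_image_cokernel f).map_of_exact
    (forget₂ (FGModuleCat.{u} A) (ModuleCat.{u} A))
  exact hS₂.hasProjectiveDimensionLT_X₂ (n + 1) (hS₁.hasProjectiveDimensionLT_X₃ n hk hX)
    (inferInstanceAs (HasProjectiveDimensionLT (cokernel f).obj (n + 1)))

theorem shortExact_kernel {C : Type*} [Category* C] [Abelian C] {X Y : C} (p : X ⟶ Y) [Epi p] :
    (ShortComplex.mk (kernel.ι p) p (kernel.condition p)).ShortExact where
  exact := ShortComplex.exact_kernel p

theorem projective_of_projective_obj (M : FGModuleCat.{u} A) (h : Projective M.obj) :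
    Projective M where
  factors {E X} f e he := by
    have he' : Epi e.hom :=
      (inferInstance : Epi ((forget₂ (FGModuleCat.{u} A) (ModuleCat.{u} A)).map e))
    exact ⟨ObjectProperty.homMk (h.factors f.hom _).choose,
      ObjectProperty.hom_ext _ (h.factors f.hom _).choose_spec⟩

/-- Finitely generated modules of finite projective dimension are perfect. -/
theorem perfectComplexes_of_hasProjectiveDimensionLT (n : ℕ) : ∀ (M : FGModuleCat.{u} A),
    HasProjectiveDimensionLT M.obj (n + 1) → perfectComplexes (FGModuleCat.{u} A)
      ((DerivedCategory.singleFunctor (FGModuleCat.{u} A) 0).obj M) := by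
  induction n with
  | zero =>
    intro M hM
    have := projective_of_projective_obj M inferInstance
    exact perfectComplexes_single_of_projective M
  | succ n hn =>
    intro M hM
    obtain ⟨k, p, hp⟩ := exists_epi_free M
    have hS := shortExact_kernel p
    have hS' := hS.map_of_exact (forget₂ (FGModuleCat.{u} A) (ModuleCat.{u} A))
    -- The syzygy has dimension one less; `M` is then the cone of a map from a perfect object to a
    -- free module.
    have hK : HasProjectiveDimensionLT (kernel p).obj (n + 1) :=
      hS'.hasProjectiveDimensionLT_X₁ (n + 1)
        (by
          have : Projective (ModuleCat.of A (Fin k → A)) :=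
            (IsProjective.iff_projective (R := A) _).1 inferInstance
          have : HasProjectiveDimensionLT (ModuleCat.of A (Fin k → A)) 1 := inferInstance
          exact hasProjectiveDimensionLT_of_ge (ModuleCat.of A (Fin k → A)) 1 (n + 1) (by lia)) hM
    refine ObjectProperty.ext_of_isTriangulatedClosed₃ _ _ hS.singleTriangle_distinguished
      (hn _ hK) (perfectComplexes_single_of_projective _)

end

/-! ### Projective dimension bounds for the left retraction. -/

section

variable {A : Type u} [Ring A] [IsArtinAlgebra A] (S : ModuleCat.{u} A) [IsLocalizable S]

theorem hasProjectiveDimensionLT_kernel_unit (X : FGModuleCat.{u} A) :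
    HasProjectiveDimensionLT (kernel ((iLambdaResAdj S).unit.app X)).obj 2 := by
  have hspec := (exists_maximal S).choose_spec
  have := hspec.2.1
  have : Module.Finite A (kernel ((iLambdaResAdj S).unit.app X) : FGModuleCat.{u} A) :=
    (kernel ((iLambdaResAdj S).unit.app X) : FGModuleCat.{u} A).property
  refine hasProjectiveDimensionLT_of_tors_eq_top hspec.1 (tors_kernel_eq_top hspec.1 _ ?_)
  have h := (exists_universal S X).choose_spec.choose_spec.2.1
  rw [← locUnit_app_eq] at h
  exact h

/-- The unit at `X` is, up to isomorphism, the localization map of `X`. -/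
theorem exists_iso_unit_app (X : FGModuleCat.{u} A) :
    ∃ e : ((iLambda S).obj X).obj ≅ (iRes S).obj ((iLambdaRes S).obj X),
      (iLambdaResAdj S).unit.app X = (locUnit S).app X ≫ e.hom :=
  ⟨(perp S).ι.mapIso ((perpEquivalence S).unitIso.app ((iLambda S).obj X)), rfl⟩

theorem hasProjectiveDimensionLT_cokernel_locUnit (X : FGModuleCat.{u} A) :
    HasProjectiveDimensionLT (cokernel ((locUnit S).app X)).obj 2 := by
  have hspec := (exists_maximal S).choose_spec
  have := hspec.2.1
  have : Module.Finite A (cokernel ((locUnit S).app X) : FGModuleCat.{u} A) :=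
    (cokernel ((locUnit S).app X) : FGModuleCat.{u} A).property
  refine hasProjectiveDimensionLT_of_tors_eq_top hspec.1 (tors_cokernel_eq_top _ ?_)
  have h := (exists_universal S X).choose_spec.choose_spec.2.2
  rw [← locUnit_app_eq] at h
  exact h

/-- The target here carries the action restricted along `η_A`, so the bound for `locUnit` is
transported along the isomorphism with the original module. -/
theorem hasProjectiveDimensionLT_cokernel_unit (X : FGModuleCat.{u} A) :
    HasProjectiveDimensionLT (cokernel ((iLambdaResAdj S).unit.app X)).obj 2 := by
  obtain ⟨e, he⟩ := exists_iso_unit_app S X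
  have := hasProjectiveDimensionLT_cokernel_locUnit S X
  let e' : (cokernel ((iLambdaResAdj S).unit.app X)).obj ≅ (cokernel ((locUnit S).app X)).obj :=
    (ModuleCat.isFG A).ι.mapIso (cokernelIsoOfEq he ≪≫ cokernelCompIsIso _ e.hom)
  exact hasProjectiveDimensionLT_of_iso e'.symm 2

/-- The kernel and cokernel of the unit have dimension at most one, which keeps the bound two; for
`X = A` it yields the bound on `L(A)`. -/
theorem hasProjectiveDimensionLT_iRes_iLambdaRes (X : FGModuleCat.{u} A)
    (hX : HasProjectiveDimensionLT X.obj 3) :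
    HasProjectiveDimensionLT ((iLambdaRes S ⋙ iRes S).obj X).obj 3 := by
  have hk := hasProjectiveDimensionLT_kernel_unit S X
  have hc := hasProjectiveDimensionLT_cokernel_unit S X
  generalize (iLambdaResAdj S).unit.app X = f at hk hc
  exact hasProjectiveDimensionLT_of_kernel_cokernel f 2 hk hX hc

theorem hasProjectiveDimensionLT_perp (Y : (perp S).FullSubcategory) (n : ℕ)
    (hY : HasProjectiveDimensionLT ((lAlgToPerp S).obj ((perpToLAlg S).obj Y)).obj.obj n) :
    HasProjectiveDimensionLT Y.obj.obj n := by
  let e : Y.obj.obj ≅ ((lAlgToPerp S).obj ((perpToLAlg S).obj Y)).obj.obj :=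
    ((perp S).ι ⋙ (ModuleCat.isFG A).ι).mapIso ((perpEquivalence S).unitIso.app Y)
  exact hasProjectiveDimensionLT_of_iso e.symm n

theorem hasProjectiveDimensionLT_LObj : HasProjectiveDimensionLT (LObj S).obj.obj 3 :=
  hasProjectiveDimensionLT_perp S (LObj S) 3
    (hasProjectiveDimensionLT_iRes_iLambdaRes S (FGModuleCat.of A A)
      (inferInstanceAs (HasProjectiveDimensionLT (ModuleCat.of A A) 3)))

/-- The `A`-module `L(A)` has projective dimension at most two. -/
theorem hasProjectiveDimensionLT_LAlg :
    HasProjectiveDimensionLT (ModuleCat.of A (LAlg S)) 3 :=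
  hasProjectiveDimensionLT_LObj S

/-- A finitely generated projective is a summand of some `L(A)^k`. Restriction preserves the
splitting, and `L(A)` has dimension at most two over `A`. -/
theorem hasProjectiveDimensionLT_iRes_of_projective (P : FGModuleCat.{u} (LAlg S)) [Projective P] :
    HasProjectiveDimensionLT ((iRes S).obj P).obj 3 := by
  obtain ⟨k, p, hp⟩ := exists_epi_free P
  let q : (iRes S).obj (FGModuleCat.of (LAlg S) (Fin k → LAlg S)) →ₗ[A] (iRes S).obj P :=
    ((iRes S).map p).hom.hom
  let σ : (iRes S).obj P →ₗ[A] (iRes S).obj (FGModuleCat.of (LAlg S) (Fin k → LAlg S)) :=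
    ((iRes S).map (Projective.factorThru (𝟙 P) p)).hom.hom
  have := hasProjectiveDimensionLT_LAlg S
  -- The coordinatewise `A`-action coincides with the one restricted along `η_A`, because `η_A(a) ⋆
  -- y = a • y`.
  let ε : (Fin k → LAlg S) ≃ₗ[A] (iRes S).obj (FGModuleCat.of (LAlg S) (Fin k → LAlg S)) :=
    { toFun := fun x => x
      invFun := fun x => x
      left_inv := fun _ => rfl
      right_inv := fun _ => rfl
      map_add' := fun _ _ => rfl
      map_smul' := fun a x => funext fun i => (retraction_mul S a (x i)).symm }
  refine hasProjectiveDimensionLT_of_retract_pi (X := (iRes S).obj P) (q ∘ₗ ε.toLinearMap)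
    (ε.symm.toLinearMap ∘ₗ σ) ?_
  refine LinearMap.ext fun x => ?_
  exact LinearMap.congr_fun (congrArg (fun g => g.hom.hom) (Projective.factorThru_comp (𝟙 P) p))
    (show P from x)

/-- The right adjoint is an equivalence followed by the inclusion of a full subcategory, hence fully
faithful. -/
theorem isIso_counit : IsIso (iLambdaResAdj S).counit := by
  have : (lAlgToPerp S).IsEquivalence := (perpEquivalence S).isEquivalence_inverse
  let e : lAlgToPerp S ⋙ (perp S).ι ≅ iRes S := (perp S).liftCompιIso (iRes S) (perp_iRes S)
  have := Functor.Full.of_iso e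
  have := Functor.Faithful.of_iso e
  infer_instance

end

end LeftRetraction
end

theorem mainTheorem5 {A : Type u} [Ring A] [IsArtinAlgebra A] (S : ModuleCat.{u} A)
    [IsLocalizable S] :
    (∀ X : Db A, perf A X → perf (LAlg S) ((iLambdaStar S).obj X)) ∧
    (∀ Y : Db (LAlg S), perf (LAlg S) Y → perf A ((iStar S).obj Y)) ∧
    ∃ (e : Dsg A ≌ Dsg (LAlg S)) (_ : e.functor.CommShift ℤ) (_ : e.inverse.CommShift ℤ)
      (_ : e.CommShift ℤ),
      e.IsTriangulated ∧
      (∃ α : quot A ⋙ e.functor ≅ iLambdaStar S ⋙ quot (LAlg S), NatTrans.CommShift α.hom ℤ) ∧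
      (∃ β : quot (LAlg S) ⋙ e.inverse ≅ iStar S ⋙ quot A, NatTrans.CommShift β.hom ℤ) := by
  have hF (M : FGModuleCat.{u} A) [Projective M] : perfectComplexes (FGModuleCat.{u} (LAlg S))
      ((DerivedCategory.singleFunctor _ 0).obj ((iLambdaRes S).obj M)) := by
    -- A left adjoint preserves projectives as soon as its right adjoint preserves epimorphisms, and
    -- restriction of scalars is exact.
    have := (iLambdaResAdj S).map_projective M inferInstance
    exact perfectComplexes_single_of_projective _
  have hG (M : FGModuleCat.{u} (LAlg S)) [Projective M] : perfectComplexes (FGModuleCat.{u} A)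
      ((DerivedCategory.singleFunctor _ 0).obj ((iRes S).obj M)) :=
    perfectComplexes_of_hasProjectiveDimensionLT 2 _
      (hasProjectiveDimensionLT_iRes_of_projective S M)
  have := isIso_counit S
  exact ⟨boundedPerf_mapBounded _ hF, boundedPerf_mapBounded _ hG,
    exists_equivalence_of_perfect_unit (iLambdaResAdj S).unit (inv (iLambdaResAdj S).counit) hF hG
      (fun M => perfectComplexes_of_hasProjectiveDimensionLT 1 _
        (hasProjectiveDimensionLT_kernel_unit S M))
      (fun M => perfectComplexes_of_hasProjectiveDimensionLT 1 _
        (hasProjectiveDimensionLT_cokernel_unit S M))⟩
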